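/- **Setting.** Base stations and devices form homogeneous Poisson point processes in the plane of densities $\lambda>0$ and $\mu>0$; put $\alpha=\mu/\lambda$. Path loss is $r^{-\eta}$ with $\eta>2$; channel power gains are i.i.d. exponential with mean $1$ (Rayleigh fading); each device uses one of $n_Z\ge1$ random access codes, chosen uniformly and independently. Under Channel-Gain-Based Clustering a device is a cluster head (CH) if its channel gain exceeds $\tau=-\ln\delta$, where $0<\delta\le1$ is the fraction of CHs. A CH at distance $R$ from its nearest base station transmits with power $\rho_{\rm L}R^{\eta}$, $\rho_{\rm L}>0$ (full path-loss inversion). The test CH has gain $h_\circ$ and is served by a base station at the origin; $\sigma^2\ge0$ is the noise power and $\theta>0$ the detection threshold. The following usual approximations define the model. * *Inter-cell interference* $\mathcal I_{\rm Out}$: sum of $P_mh_mr_m^{-\eta}$ over all CHs of the device process that use the code of the test CH and satisfy $P_mr_m^{-\eta}<\rho_{\rm L}$, where $r_m$ is the distance to the origin and $P_m=\rho_{\rm L}R_m^{\eta}$. The $R_m$ are i.i.d. (spatial correlations of transmit powers are ignored), distributed like the distance from a fixed location to the nearest base station. * *Intra-cell interference* $\mathcal I_{\rm In}$: sum of $\rho_{\rm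 L}h_i$ over the CHs among the devices of the test cell that use the code of the test CH. The number of devices in the cell is Poisson with mean $\mu A$ given the cell area $A$, and $A$ is Gamma distributed with shape $c=3.575$ and mean $1/\lambda$. * The gain $h_\circ$, the number of devices in the test cell, the gains and codes of these devices, the device process, and the triples (distance, gain, code) attached to its points are mutually independent. Let $\mathcal I=\mathcal I_{\rm In}+\mathcal I_{\rm Out}$, $F_{\mathcal I}(x)=\mathbb P(\mathcal I\le x)$, $\bar F_{\mathcal I}=1-F_{\mathcal I}$, and $$P_{\rm RA}=\mathbb P\Big(\frac{\rho_{\rm L}h_\circ}{\sigma^2+\mathcal I}>\theta\;\Big|\;h_\circ>\tau\Big),\qquad x_0=\frac{\tau\rho_{\rm L}}{\theta}-\sigma^2 .$$ **Theorem.** The sum defining $\mathcal I_{\rm Out}$ converges almost surely, and the following hold. 1. For $s\in\mathbb C$ with $\operatorname{Re}s\ge0$, $$\mathbb E\,e^{-s\mathcal I_{\rm Out}}=\mathscr L_{\rm Out}(s):=\exp\Big\{-\frac{2\delta\alpha}{n_Z}\rho_{\rm L}^{2/\eta}\int_{\rho_{\rm L}^{-1/\eta}}^\infty\Big(1-\frac{e^{-\tau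 sy^{-\eta}}}{1+sy^{-\eta}}\Big)y\,dy\Big\},$$ $$\mathbb E\,e^{-s\mathcal I_{\rm In}}=\mathscr L_{\rm In}(s):=\Big(1+\frac{\delta\alpha\,\big((1+s\rho_{\rm L})-e^{-\tau s\rho_{\rm L}}\big)}{n_Z(1+s\rho_{\rm L})c}\Big)^{-c},$$ and $\mathbb E\,e^{-s\mathcal I}=\mathscr L_{\mathcal I}(s):=\mathscr L_{\rm Out}(s)\mathscr L_{\rm In}(s)$. 2. For every real $x$, with an absolutely convergent integral, $$F_{\mathcal I}(x)=\frac12-\frac1\pi\int_0^\infty\frac1t\operatorname{Im}\big\{e^{-jtx}\mathscr L_{\mathcal I}(-jt)\big\}\,dt .$$ 3. The random access success probability is approximately $$P_{\rm RA}\approx\widehat P:=\frac{\exp\Big\{-\frac{\sigma^2\theta}{\rho_{\rm L}}+\tau-\frac{2\delta\alpha}{n_Z}\theta^{2/\eta}\int_{\theta^{-1/\eta}}^\infty\Big(1-\frac{e^{-\tau y^{-\eta}}}{1+y^{-\eta}}\Big)y\,dy\Big\}}{\Big(1+\frac{\delta\alpha((1+\theta)-e^{-\tau\theta})}{n_Z(1+\theta)c}\Big)^{c}}\;\bar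 F_{\mathcal I}(x_0)+F_{\mathcal I}(x_0).$$ Here the sign $\approx$ means that the covariance of $e^{\tau-\theta(\sigma^2+\mathcal I)/\rho_{\rm L}}$ and $\mathbf 1_{\{\mathcal I>x_0\}}$ is neglected: exactly, $$P_{\rm RA}=\widehat P+\operatorname{Cov}\big(e^{\tau-\theta(\sigma^2+\mathcal I)/\rho_{\rm L}},\,\mathbf 1_{\{\mathcal I>x_0\}}\big),$$ and this covariance is $\le0$, so that $P_{\rm RA}\le\widehat P$. -/

import Mathlib

open MeasureTheory ProbabilityTheory Set
open scoped ENNReal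

noncomputable section

namespace RandomAccess

/-- The Euclidean plane. -/
abbrev Plane := EuclideanSpace ℝ (Fin 2)

/-- The random points `X 0, X 1, …` of the plane form a homogeneous Poisson point process of
intensity `a`: the numbers of points in disjoint measurable sets of finite area are independent, and
the number of points in `B` is Poisson distributed with mean `a * area B`. -/
def IsPoissonProcess {Ω : Type*} [MeasurableSpace Ω] (P : Measure Ω) (a : ℝ)
    (X : ℕ → Ω → Plane) : Prop :=
  (∀ i, Measurable (X i)) ∧
  ∀ (n : ℕ) (B : Fin n → Set Plane) (k : Fin n → ℕ),
    (∀ i, MeasurableSet (B i)) → (∀ i, volume (B i) ≠ ∞) →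
    (∀ i j, i ≠ j → Disjoint (B i) (B j)) →
    P {ω | ∀ i, {m | X m ω ∈ B i}.encard = (k i : ℕ∞)} =
      ∏ i, poissonMeasure (a * (volume (B i)).toReal).toNNReal {k i}

/-- Distance from the origin to the nearest of the points `X 0 ω, X 1 ω, …`. -/
def nearestDist {Ω : Type*} (X : ℕ → Ω → Plane) (ω : Ω) : ℝ := ⨅ m, ‖X m ω‖

/-- The constant of the Gamma approximation of the area of a planar Poisson-Voronoi cell. -/
def voronoiConst : ℝ := 3.575

/-- The random objects seen by a test cluster head that is served by a base station at the origin.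
`lam` and `mu` are the densities of base stations and devices, `nZ` is the number of Zadoff-Chu
codes. Every device has a service distance (to its own nearest base station), a channel power gain
towards the test base station and a code.
* Devices outside the test cell are taken from a Poisson process with independent marks; spatial
  correlations between service distances are ignored.
* The number of devices in the test cell is Poisson given the area of the cell, and that area is
  Gamma distributed with shape `voronoiConst` and mean `1 / lam`. -/
structure Network {Ω : Type*} [MeasurableSpace Ω] (P : Measure Ω) (lam mu : ℝ) (nZ : ℕ) where
  /-- the base stations -/
  bs : ℕ → Ω → Plane
  bs_poisson : IsPoissonProcess P lam bs
  /-- the devices of the network -/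
  dev : ℕ → Ω → Plane
  dev_poisson : IsPoissonProcess P mu dev
  /-- service distance, channel gain and code of each device of the network -/
  mark : ℕ → Ω → ℝ × ℝ × Fin nZ
  mark_meas : ∀ m, Measurable (mark m)
  /-- the service distance is distributed like the distance from a fixed location to the nearest
  base station, gains are exponential of mean one (Rayleigh fading), codes are uniform -/
  mark_law : ∀ m, P.map (mark m) =
    (P.map (nearestDist bs)).prod ((expMeasure 1).prod (uniformOn Set.univ))
  mark_indep : iIndepFun mark P
  /-- number of other devices in the test cell -/
  cellNum : Ω → ℕ
  cellNum_meas : Measurable cellNum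
  cellNum_law : ∀ n : ℕ, P {ω | cellNum ω = n} =
    ∫⁻ a, poissonMeasure (mu * a).toNNReal {n} ∂(gammaMeasure voronoiConst (voronoiConst * lam))
  /-- channel gain and code of each device in the test cell -/
  cellMark : ℕ → Ω → ℝ × Fin nZ
  cellMark_meas : ∀ i, Measurable (cellMark i)
  cellMark_law : ∀ i, P.map (cellMark i) = (expMeasure 1).prod (uniformOn Set.univ)
  cellMark_indep : iIndepFun cellMark P
  /-- channel gain of the test device -/
  gain : Ω → ℝ
  gain_meas : Measurable gain
  gain_law : P.map gain = expMeasure 1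
  /-- the following four conditions say that `gain`, `cellNum`, the sequence `cellMark`, the
  process `dev` and the sequence `mark` are mutually independent -/
  indep_gain : IndepFun gain
    (fun ω => (cellNum ω, (fun i => cellMark i ω), (fun m => dev m ω), (fun m => mark m ω))) P
  indep_cellNum : IndepFun cellNum
    (fun ω => ((fun i => cellMark i ω), (fun m => dev m ω), (fun m => mark m ω))) P
  indep_cellMark : IndepFun (fun ω i => cellMark i ω)
    (fun ω => ((fun m => dev m ω), (fun m => mark m ω))) P
  indep_dev : IndepFun (fun ω m => dev m ω) (fun ω m => mark m ω) P

namespace Network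

variable {Ω : Type*} [MeasurableSpace Ω] {P : Measure Ω} {lam mu : ℝ} {nZ : ℕ}

open Classical in
/-- Contribution of the `m`-th device to the inter-cell interference. The device transmits if it is
a cluster head (gain above `τ`) on the code `z₀` of the test cluster head. Its power is
`ρ * R ^ η` with `R` its service distance (full path-loss inversion). It belongs to another cell,
so its mean power received at the test base station is below `ρ`. -/
def interTerm (N : Network P lam mu nZ) (η ρ τ : ℝ) (z₀ : Fin nZ) (m : ℕ) (ω : Ω) : ℝ :=
  let R := (N.mark m ω).1
  let h := (N.mark m ω).2.1
  let z := (N.mark m ω).2.2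
  let g := ρ * R ^ η * ‖N.dev m ω‖ ^ (-η)
  if τ < h ∧ z = z₀ ∧ g < ρ then g * h else 0

/-- Inter-cell interference. -/
def interInterference (N : Network P lam mu nZ) (η ρ τ : ℝ) (z₀ : Fin nZ) (ω : Ω) : ℝ :=
  ∑' m, N.interTerm η ρ τ z₀ m ω

open Classical in
/-- Intra-cell interference: the cluster heads of the test cell on the code `z₀`, each received
with mean power `ρ`. -/
def intraInterference (N : Network P lam mu nZ) (ρ τ : ℝ) (z₀ : Fin nZ) (ω : Ω) : ℝ :=
  ∑ i ∈ Finset.range (N.cellNum ω),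
    if τ < (N.cellMark i ω).1 ∧ (N.cellMark i ω).2 = z₀ then ρ * (N.cellMark i ω).1 else 0

/-- Aggregate interference. -/
def interference (N : Network P lam mu nZ) (η ρ τ : ℝ) (z₀ : Fin nZ) (ω : Ω) : ℝ :=
  N.intraInterference ρ τ z₀ ω + N.interInterference η ρ τ z₀ ω

/-- Signal to interference and noise ratio of the random access attempt of the test device. -/
def sinr (N : Network P lam mu nZ) (η ρ τ σ : ℝ) (z₀ : Fin nZ) (ω : Ω) : ℝ :=
  ρ * N.gain ω / (σ ^ 2 + N.interference η ρ τ z₀ ω)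

/-- Success probability of random access under channel-gain-based clustering: probability that the
SINR exceeds `θ`, given that the test device is a cluster head. -/
def successProb (N : Network P lam mu nZ) (η ρ τ σ θ : ℝ) (z₀ : Fin nZ) : ℝ :=
  (P[|{ω | τ < N.gain ω}] {ω | θ < N.sinr η ρ τ σ z₀ ω}).toReal

/-- Distribution function of the aggregate interference. -/
def interferenceCDF (N : Network P lam mu nZ) (η ρ τ : ℝ) (z₀ : Fin nZ) (x : ℝ) : ℝ :=
  (P {ω | N.interference η ρ τ z₀ ω ≤ x}).toReal

/-- Complementary distribution function of the aggregate interference. -/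
def interferenceCCDF (N : Network P lam mu nZ) (η ρ τ : ℝ) (z₀ : Fin nZ) (x : ℝ) : ℝ :=
  (P {ω | x < N.interference η ρ τ z₀ ω}).toReal

end Network

/-- Closed form of the Laplace transform of the inter-cell interference, `K = δ α / n_Z`. -/
def interLaplace (K η ρ τ : ℝ) (s : ℂ) : ℂ :=
  Complex.exp (-(2 * K * (ρ ^ (2 / η) : ℝ) *
    ∫ y in Ioi (ρ ^ (-1 / η)),
      (1 - Complex.exp (-τ * s * (y ^ (-η) : ℝ)) / (s * (y ^ (-η) : ℝ) + 1)) * y))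

/-- Closed form of the Laplace transform of the intra-cell interference, `K = δ α / n_Z`. -/
def intraLaplace (K ρ τ : ℝ) (s : ℂ) : ℂ :=
  1 / (1 + K * ((1 + s * ρ) - Complex.exp (-τ * s * ρ)) / ((1 + s * ρ) * voronoiConst))
    ^ (voronoiConst : ℂ)

end RandomAccess

end

namespace RandomAccess

open Filter Topology

/-! ### Generating functionals of Poisson processes -/

/-! Every assertion reduces to the Laplace transform of `𝓘` on the closed half-plane `Re s ≥ 0`. Its
boundary values `s = -it` give the characteristic function, and its value at `s = θ / ρ` gives the
closed form in the success probability.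

For the inter-cell part the basic tool is the generating functional `E ∏ (1 - v (X m)) = exp (-a ∫
v)` (`IsPoissonProcess.integral_tprod`). For simple `v` the product depends only on finitely many
independent Poisson counts. The general case follows by `L¹` approximation, since products of
complex numbers in the unit disc are Lipschitz in the sum of the differences and Campbell's formula
bounds the expected sum. Integrating independent marks out first gives the marked version
`integral_exp_neg_tsum_marked`. A device at `x` with service distance `R` is in another cell exactly
when `‖x / R‖ > 1`, and its mean received power depends only on `x / R`. The plane integral
therefore splits into `E R² = 1 / (π lam)`, a radial integral over `r > 1`, and the gain/code
average `e^{-τ} / nZ * gainDefect`. The condition `η > 2` makes the radial integral converge.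

The intra-cell part is a compound sum. A Poisson count with Gamma-distributed mean area has
generating function `(1 + mu (1 - q) / (c lam))^(-c)`, evaluated at the transform `q` of one device
(`Network.integral_pow_cellNum`). Complex arguments in the Gamma transform are reached by the
identity theorem. Independence multiplies the two parts.

Gil-Pelaez inversion (`measureReal_Iic_eq_gilPelaez`) is proved under a first moment, which controls
the integrand at `t = 0`, and integrability of the characteristic function, which controls it at
infinity and excludes atoms. The latter comes from the inter-cell factor alone, bounded by `exp (-(K
/ 4) ((tρ)^(2/η) - 1))`; the intra-cell interference has an atom at zero, so its own transform does
not decay to zero.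

For the success probability, conditioning on `𝓘` and using the exponential tail of the gain gives `E
exp (τ - max τ (θ (σ² + 𝓘) / ρ))`. The maximum switches at `𝓘 = x₀`, so this is `P(𝓘 ≤ x₀) + E[W ·
1_{𝓘 > x₀}]` with `W = exp (τ - θ (σ² + 𝓘) / ρ)`; splitting the last expectation produces the
covariance. Its sign holds because `W ≤ 1` on the event and `W ≥ 1` off it. -/

theorem norm_prod_sub_prod_le_sum {ι : Type*} (s : Finset ι) (a b : ι → ℂ)
    (ha : ∀ i, ‖a i‖ ≤ 1) (hb : ∀ i, ‖b i‖ ≤ 1) :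
    ‖∏ i ∈ s, a i - ∏ i ∈ s, b i‖ ≤ ∑ i ∈ s, ‖a i - b i‖ := by
  classical
  induction s using Finset.induction_on with
  | empty => simp
  | insert i s hi ih =>
    rw [Finset.prod_insert hi, Finset.prod_insert hi, Finset.sum_insert hi]
    have hP : ‖∏ j ∈ s, a j‖ ≤ 1 := by
      rw [norm_prod]
      exact Finset.prod_le_one (fun _ _ => norm_nonneg _) fun j _ => ha j
    calc ‖a i * ∏ j ∈ s, a j - b i * ∏ j ∈ s, b j‖
        = ‖(a i - b i) * ∏ j ∈ s, a j + b i * (∏ j ∈ s, a j - ∏ j ∈ s, b j)‖ := by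
          congr 1; ring
      _ ≤ ‖a i - b i‖ * ‖∏ j ∈ s, a j‖ + ‖b i‖ * ‖∏ j ∈ s, a j - ∏ j ∈ s, b j‖ := by
          rw [← norm_mul, ← norm_mul]; exact norm_add_le _ _
      _ ≤ ‖a i - b i‖ * 1 + 1 * ∑ j ∈ s, ‖a j - b j‖ := by
          gcongr
          exact hb i
      _ = _ := by ring

theorem norm_tprod_sub_tprod_le (a b : ℕ → ℂ) (ha : ∀ i, ‖a i‖ ≤ 1) (hb : ∀ i, ‖b i‖ ≤ 1)
    (hma : Multipliable a) (hmb : Multipliable b) :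
    ‖∏' i, a i - ∏' i, b i‖ₑ ≤ ∑' i, ‖a i - b i‖ₑ := by
  have h1 := (hma.hasProd.tendsto_prod_nat.sub hmb.hasProd.tendsto_prod_nat).enorm
  refine le_of_tendsto h1 (Eventually.of_forall fun n => ?_)
  refine le_trans ?_ (ENNReal.sum_le_tsum (Finset.range n))
  have h2 := norm_prod_sub_prod_le_sum (Finset.range n) a b ha hb
  rw [← ofReal_norm]
  refine (ENNReal.ofReal_le_ofReal h2).trans ?_
  rw [ENNReal.ofReal_sum_of_nonneg fun _ _ => norm_nonneg _]
  simp

theorem norm_tprod_le_one (a : ℕ → ℂ) (ha : ∀ i, ‖a i‖ ≤ 1) (hma : Multipliable a) :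
    ‖∏' i, a i‖ ≤ 1 := by
  refine le_of_tendsto hma.hasProd.tendsto_prod_nat.norm (Eventually.of_forall fun n => ?_)
  rw [norm_prod]
  exact Finset.prod_le_one (fun _ _ => norm_nonneg _) fun j _ => ha j

theorem integral_pow_poissonMeasure (r : NNReal) (z : ℂ) :
    ∫ n, z ^ n ∂(poissonMeasure r) = Complex.exp (r * (z - 1)) := by
  rw [integral_poissonMeasure]
  calc ∑' n : ℕ, (Real.exp (-r) * (r : ℝ) ^ n / n.factorial : ℝ) • z ^ n
      = ∑' n : ℕ, Complex.exp (-r) * ((r * z) ^ n / n.factorial) := by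
        congr with n
        rw [Complex.real_smul, mul_pow]
        push_cast
        ring
    _ = Complex.exp (-r) * Complex.exp (r * z) := by
        rw [tsum_mul_left, (NormedSpace.expSeries_div_hasSum_exp ((r : ℂ) * z)).tsum_eq,
          Complex.exp_eq_exp_ℂ]
    _ = _ := by
        rw [← Complex.exp_add]; ring_nf

theorem lintegral_natCast_poissonMeasure (r : NNReal) :
    ∫⁻ n, (n : ℝ≥0∞) ∂(poissonMeasure r) = r := by
  rw [lintegral_countable', tsum_eq_zero_add' ENNReal.summable]
  have h : ∀ n : ℕ, ((n + 1 : ℕ) : ℝ≥0∞) * poissonMeasure r {n + 1} =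
      r * poissonMeasure r {n} := by
    intro n
    rw [poissonMeasure_singleton, poissonMeasure_singleton, ← ENNReal.ofReal_coe_nnreal,
      ← ENNReal.ofReal_natCast, ← ENNReal.ofReal_mul (by positivity),
      ← ENNReal.ofReal_mul (by positivity), Nat.factorial_succ]
    congr 1
    push_cast
    field_simp
    ring
  have h1 : ∑' n : ℕ, poissonMeasure r {n} = 1 := by
    have := lintegral_countable' (μ := poissonMeasure r) fun _ => (1 : ℝ≥0∞)
    simpa using this.symm
  simp_rw [h, ENNReal.tsum_mul_left, h1]
  simp

section PoissonProcess

variable {Ω : Type*} [MeasurableSpace Ω] {P : Measure Ω} [IsProbabilityMeasure P] {a : ℝ}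
  {X : ℕ → Ω → Plane}

omit [MeasurableSpace Ω] in
theorem encard_eq_tsum_indicator (X : ℕ → Ω → Plane) (B : Set Plane) (ω : Ω) :
    (({m | X m ω ∈ B}.encard : ℕ∞) : ℝ≥0∞) = ∑' m, B.indicator 1 (X m ω) := by
  have h : (fun m => B.indicator (1 : Plane → ℝ≥0∞) (X m ω)) =
      {m | X m ω ∈ B}.indicator fun _ => 1 := by
    ext m; simp [indicator]
  rw [h, ← tsum_subtype, ENNReal.tsum_set_one]

theorem measurableSet_encard_eq (hX : ∀ m, Measurable (X m)) {B : Set Plane}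
    (hB : MeasurableSet B) (k : ℕ∞) : MeasurableSet {ω | {m | X m ω ∈ B}.encard = k} := by
  have h : {ω | {m | X m ω ∈ B}.encard = k} =
      (fun ω => ∑' m, B.indicator (1 : Plane → ℝ≥0∞) (X m ω)) ⁻¹' {(k : ℝ≥0∞)} := by
    ext ω
    simp [← encard_eq_tsum_indicator]
  rw [h]
  refine (Measurable.tsum fun m => ?_) (measurableSet_singleton _)
  exact (measurable_one.indicator hB).comp (hX m)

theorem measurable_ncard (hX : ∀ m, Measurable (X m)) {B : Set Plane}
    (hB : MeasurableSet B) : Measurable fun ω => {m | X m ω ∈ B}.ncard := by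
  refine measurable_to_countable' fun k => ?_
  have h : (fun ω => {m | X m ω ∈ B}.ncard) ⁻¹' {k} =
      ⋃ j ∈ {j : ℕ∞ | j.toNat = k}, {ω | {m | X m ω ∈ B}.encard = j} := by
    ext ω; simp [Set.ncard_def]
  rw [h]
  exact MeasurableSet.biUnion (Set.to_countable _) fun j _ => measurableSet_encard_eq hX hB j

namespace IsPoissonProcess

omit [IsProbabilityMeasure P] in
theorem measure_forall_encard (hX : IsPoissonProcess P a X) {ι : Type*} [Fintype ι]
    (B : ι → Set Plane) (k : ι → ℕ) (hB : ∀ i, MeasurableSet (B i)) (hf : ∀ i, volume (B i) ≠ ∞)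
    (hd : ∀ i j, i ≠ j → Disjoint (B i) (B j)) :
    P {ω | ∀ i, {m | X m ω ∈ B i}.encard = (k i : ℕ∞)} =
      ∏ i, poissonMeasure (a * (volume (B i)).toReal).toNNReal {k i} := by
  let e := Fintype.equivFin ι
  have h := hX.2 (Fintype.card ι) (fun i => B (e.symm i)) (fun i => k (e.symm i))
    (fun i => hB _) (fun i => hf _) fun i j hij => hd _ _ fun h => hij (e.symm.injective h)
  rw [← e.symm.prod_comp, ← h]
  congr 1
  ext ω
  exact (e.symm.forall_congr_right (q := fun i => {m | X m ω ∈ B i}.encard = (k i : ℕ∞))).symm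

omit [IsProbabilityMeasure P] in
theorem measure_encard (hX : IsPoissonProcess P a X) {B : Set Plane}
    (hB : MeasurableSet B) (hf : volume B ≠ ∞) (k : ℕ) :
    P {ω | {m | X m ω ∈ B}.encard = (k : ℕ∞)} =
      poissonMeasure (a * (volume B).toReal).toNNReal {k} := by
  simpa using hX.measure_forall_encard (ι := Unit) (fun _ => B) (fun _ => k) (fun _ => hB)
    (fun _ => hf) fun i j h => (h rfl).elim

/-- The definition only prescribes the probabilities of finite counts. They are Poisson weights with
total mass one, so nothing is left for infinite counts. Afterwards `encard` may be replaced by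
`ncard` almost surely. -/
theorem ae_finite (hX : IsPoissonProcess P a X) {B : Set Plane}
    (hB : MeasurableSet B) (hf : volume B ≠ ∞) :
    ∀ᵐ ω ∂P, {m | X m ω ∈ B}.Finite := by
  have hU : {ω | {m | X m ω ∈ B}.Finite} = ⋃ k : ℕ, {ω | {m | X m ω ∈ B}.encard = (k : ℕ∞)} := by
    ext ω
    simp only [mem_ofPred_eq, mem_iUnion]
    exact ⟨fun h => ⟨_, h.cast_ncard_eq.symm⟩, fun ⟨k, hk⟩ => Set.finite_of_encard_eq_coe hk⟩
  have hm := fun k : ℕ => measurableSet_encard_eq hX.1 hB (k : ℕ∞)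
  refine (prob_compl_eq_zero_iff (hU ▸ MeasurableSet.iUnion hm)).2 ?_
  rw [hU, measure_iUnion _ hm]
  · simp_rw [hX.measure_encard hB hf]
    simpa using (lintegral_countable'
      (μ := poissonMeasure (a * (volume B).toReal).toNNReal) fun _ => (1 : ℝ≥0∞)).symm
  · intro i j hij
    refine disjoint_left.2 fun ω h1 h2 => hij ?_
    exact_mod_cast (h1.symm.trans h2 : (i : ℕ∞) = j)

/-- A measure on the countable space `ι → ℕ` is determined by its singletons, where the definition
of the process applies. The default value of `ncard` on infinite sets matters only on a null event.
-/
theorem map_ncard (hX : IsPoissonProcess P a X) {ι : Type*} [Fintype ι]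
    (B : ι → Set Plane) (hB : ∀ i, MeasurableSet (B i)) (hf : ∀ i, volume (B i) ≠ ∞)
    (hd : ∀ i j, i ≠ j → Disjoint (B i) (B j)) :
    P.map (fun ω i => {m | X m ω ∈ B i}.ncard) =
      Measure.pi fun i => poissonMeasure (a * (volume (B i)).toReal).toNNReal := by
  refine Measure.ext_of_singleton fun k => ?_
  rw [Measure.map_apply (measurable_pi_lambda _ fun i => measurable_ncard hX.1 (hB i))
    (measurableSet_singleton _), Measure.pi_singleton, ← hX.measure_forall_encard B k hB hf hd]
  refine measure_congr ?_
  filter_upwards [ae_all_iff.2 fun i => hX.ae_finite (hB i) (hf i)] with ω hω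
  refine propext ?_
  change (fun i => {m | X m ω ∈ B i}.ncard) = k ↔ ∀ i, {m | X m ω ∈ B i}.encard = (k i : ℕ∞)
  rw [funext_iff]
  refine forall_congr' fun i => ?_
  rw [← (hω i).cast_ncard_eq]
  norm_cast

/-- The intensity measure of the process: on sets of finite area both sides are the mean of a
Poisson count. -/
theorem sum_map_eq (hX : IsPoissonProcess P a X) (ha : 0 ≤ a) :
    Measure.sum (fun m => P.map (X m)) = ENNReal.ofReal a • volume := by
  have key : ∀ B : Set Plane, MeasurableSet B → volume B ≠ ∞ →
      Measure.sum (fun m => P.map (X m)) B = (ENNReal.ofReal a • volume) B := by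
    intro B hB hf
    rw [Measure.sum_apply _ hB]
    have h1 : ∑' m, P.map (X m) B = ∫⁻ ω, ({m | X m ω ∈ B}.encard : ℝ≥0∞) ∂P := by
      simp_rw [encard_eq_tsum_indicator]
      rw [lintegral_tsum (f := fun m ω => B.indicator (1 : Plane → ℝ≥0∞) (X m ω))
        fun m => ((measurable_one.indicator hB).comp (hX.1 m)).aemeasurable]
      congr with m
      rw [← lintegral_map (measurable_one.indicator hB) (hX.1 m), lintegral_indicator_one hB]
    have h2 : ∫⁻ ω, ({m | X m ω ∈ B}.encard : ℝ≥0∞) ∂P =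
        ∫⁻ ω, ({m | X m ω ∈ B}.ncard : ℝ≥0∞) ∂P := by
      refine lintegral_congr_ae ?_
      filter_upwards [hX.ae_finite hB hf] with ω hω
      rw [← hω.cast_ncard_eq]
      simp
    have h3 : P.map (fun ω => {m | X m ω ∈ B}.ncard) =
        poissonMeasure (a * (volume B).toReal).toNNReal := by
      refine Measure.ext_of_singleton fun k => ?_
      rw [Measure.map_apply (measurable_ncard hX.1 hB) (measurableSet_singleton _),
        ← hX.measure_encard hB hf]
      refine measure_congr ?_
      filter_upwards [hX.ae_finite hB hf] with ω hω
      refine propext ?_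
      change {m | X m ω ∈ B}.ncard = k ↔ {m | X m ω ∈ B}.encard = (k : ℕ∞)
      rw [← hω.cast_ncard_eq]
      norm_cast
    rw [h1, h2, ← lintegral_map (f := fun n : ℕ => (n : ℝ≥0∞)) .of_discrete
      (measurable_ncard hX.1 hB), h3, lintegral_natCast_poissonMeasure, Measure.smul_apply,
      smul_eq_mul, ← ENNReal.ofReal, ENNReal.ofReal_mul ha, ENNReal.ofReal_toReal hf]
  -- Finite area is needed for `key`, so the two measures are compared on balls exhausting the
  -- plane.
  rw [← Measure.restrict_univ (μ := Measure.sum _), ← Measure.restrict_univ (μ := _ • _),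
    ← Metric.iUnion_ball_nat (0 : Plane), Measure.restrict_iUnion_congr]
  intro n
  ext B hB
  rw [Measure.restrict_apply hB, Measure.restrict_apply hB]
  exact key _ (hB.inter measurableSet_ball)
    ((measure_mono inter_subset_right).trans_lt measure_ball_lt_top).ne

/-- Campbell's formula. It turns integrability on the plane into almost sure convergence of sums,
and `L¹` closeness on the plane into closeness of random products. -/
theorem lintegral_tsum_eq (hX : IsPoissonProcess P a X) (ha : 0 ≤ a) {u : Plane → ℝ≥0∞}
    (hu : Measurable u) :
    ∫⁻ ω, ∑' m, u (X m ω) ∂P = ENNReal.ofReal a * ∫⁻ x, u x := by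
  rw [lintegral_tsum (f := fun m ω => u (X m ω)) fun m => (hu.comp (hX.1 m)).aemeasurable]
  simp_rw [← lintegral_map hu (hX.1 _)]
  rw [← lintegral_sum_measure, hX.sum_map_eq ha, lintegral_smul_measure, smul_eq_mul]

theorem ae_summable (hX : IsPoissonProcess P a X) (ha : 0 ≤ a) {v : Plane → ℂ}
    (hv : Measurable v) (hi : Integrable v) :
    ∀ᵐ ω ∂P, Summable fun m => ‖v (X m ω)‖ := by
  have h := hX.lintegral_tsum_eq ha hv.enorm
  have hfin : ∫⁻ ω, ∑' m, ‖v (X m ω)‖ₑ ∂P ≠ ∞ := by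
    rw [h]
    exact ENNReal.mul_ne_top ENNReal.ofReal_ne_top hi.2.ne
  filter_upwards [ae_lt_top (Measurable.tsum fun m => hv.enorm.comp (hX.1 m)) hfin]
    with ω hω
  have := ENNReal.summable_toReal hω.ne
  simpa using this

theorem ae_multipliable (hX : IsPoissonProcess P a X) (ha : 0 ≤ a) {v : Plane → ℂ}
    (hv : Measurable v) (hi : Integrable v) :
    ∀ᵐ ω ∂P, Multipliable fun m => 1 - v (X m ω) := by
  filter_upwards [hX.ae_summable ha hv hi] with ω hω
  have := multipliable_one_add_of_summable (f := fun m => - v (X m ω)) (by simpa using hω)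
  simpa [sub_eq_add_neg] using this

theorem aestronglyMeasurable_tprod (hX : IsPoissonProcess P a X) (ha : 0 ≤ a) {v : Plane → ℂ}
    (hv : Measurable v) (hi : Integrable v) :
    AEStronglyMeasurable (fun ω => ∏' m, (1 - v (X m ω))) P := by
  refine aestronglyMeasurable_of_tendsto_ae atTop
    (f := fun n ω => ∏ m ∈ Finset.range n, (1 - v (X m ω))) (fun n => ?_) ?_
  · have : ∀ m, Measurable fun ω => v (X m ω) := fun m => hv.comp (hX.1 m)
    exact (Finset.measurable_fun_prod _ fun m _ => (this m).const_sub 1).aestronglyMeasurable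
  · filter_upwards [hX.ae_multipliable ha hv hi] with ω hω
    exact hω.hasProd.tendsto_prod_nat

/-- Grouping the points by the value of `v` turns the product into `∏ (1 - c) ^ N_c` with
independent Poisson counts `N_c`, whose generating functions are known. -/
theorem integral_tprod_simpleFunc (hX : IsPoissonProcess P a X) (ha : 0 ≤ a)
    (v : SimpleFunc Plane ℂ) (hi : Integrable v) :
    ∫ ω, ∏' m, (1 - v (X m ω)) ∂P = Complex.exp (-(a * ∫ x, v x)) := by
  classical
  -- The fibre over `0` can have infinite area and must be dropped; its points contribute factors
  -- `1`. Integrability makes the other fibres finite in area.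
  let ι := v.range.filter (· ≠ 0)
  let B : ι → Set Plane := fun c => v ⁻¹' {c.1}
  have hB : ∀ i, MeasurableSet (B i) := fun i => v.measurableSet_fiber _
  have hf : ∀ i, volume (B i) ≠ ∞ := fun i =>
    (SimpleFunc.measure_preimage_lt_top_of_integrable v hi (Finset.mem_filter.1 i.2).2).ne
  have hd : ∀ i j, i ≠ j → Disjoint (B i) (B j) := by
    intro i j hij
    refine Disjoint.preimage _ ?_
    simpa using fun h => hij (Subtype.ext h)
  have hprod : ∀ᵐ ω ∂P, ∏' m, (1 - v (X m ω)) =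
      ∏ i : ι, (1 - i.1) ^ {m | X m ω ∈ B i}.ncard := by
    filter_upwards [ae_all_iff.2 fun i => hX.ae_finite (hB i) (hf i)] with ω hω
    have hone : ∀ x, 1 - v x = ∏ i : ι, if x ∈ B i then 1 - i.1 else 1 := by
      intro x
      by_cases hx : v x = 0
      · rw [hx, Finset.prod_eq_one, sub_zero]
        intro i _
        rw [if_neg]
        intro h
        exact (Finset.mem_filter.1 i.2).2 (h.symm.trans hx)
      · rw [Finset.prod_eq_single (⟨v x, Finset.mem_filter.2 ⟨SimpleFunc.mem_range_self v x, hx⟩⟩ : ι)]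
        · simp [B]
        · intro j _ hj
          rw [if_neg]
          intro h
          exact hj (Subtype.ext (Eq.symm h))
        · simp
    simp_rw [hone]
    refine HasProd.tprod_eq ?_
    refine hasProd_prod fun i _ => ?_
    have := hasProd_prod_of_ne_finset_one (f := fun m => if X m ω ∈ B i then 1 - i.1 else 1)
      (s := (hω i).toFinset) (L := SummationFilter.unconditional ℕ) (by
        intro m hm
        rw [if_neg]
        simpa using hm)
    convert this using 1
    rw [Finset.prod_congr rfl (g := fun _ => 1 - i.1), Finset.prod_const,
      Set.ncard_eq_toFinset_card _ (hω i)]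
    intro m hm
    rw [if_pos]
    simpa using hm
  rw [integral_congr_ae hprod]
  have hmap := hX.map_ncard B hB hf hd
  have hmeas : Measurable fun ω (i : ι) => {m | X m ω ∈ B i}.ncard :=
    measurable_pi_lambda _ fun i => measurable_ncard hX.1 (hB i)
  rw [← integral_map (f := fun k : ι → ℕ => ∏ i : ι, (1 - i.1) ^ k i) hmeas.aemeasurable
    (by exact Measurable.of_discrete.aestronglyMeasurable), hmap,
    integral_fintype_prod_eq_prod (fun (i : ι) (k : ℕ) => (1 - i.1) ^ k)]
  simp_rw [integral_pow_poissonMeasure]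
  rw [← Complex.exp_sum]
  congr 1
  rw [SimpleFunc.integral_eq_sum v hi, Finset.mul_sum, ← Finset.sum_neg_distrib]
  rw [← Finset.sum_filter_of_ne (s := v.range) (p := (· ≠ 0)), ← Finset.sum_coe_sort (v.range.filter (· ≠ 0))]
  · refine Finset.sum_congr rfl fun i _ => ?_
    rw [Real.coe_toNNReal _ (by positivity)]
    simp [B, Measure.real]
    ring
  · intro c _ h hc
    simp [hc] at h

/-- The generating functional of a Poisson process. -/
theorem integral_tprod (hX : IsPoissonProcess P a X) (ha : 0 ≤ a)
    {v : Plane → ℂ} (hv : Measurable v) (hi : Integrable v) (h1 : ∀ x, ‖1 - v x‖ ≤ 1) :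
    ∫ ω, ∏' m, (1 - v (X m ω)) ∂P = Complex.exp (-(a * ∫ x, v x)) := by
  -- Approximating within this disc keeps every factor `1 - φ n x` in the unit disc, as the
  -- Lipschitz bound for products requires.
  let s : Set ℂ := {c | ‖1 - c‖ ≤ 1}
  have h0 : (0 : ℂ) ∈ s := by simp [s]
  let φ := SimpleFunc.approxOn v hv s 0 h0
  have hφi : ∀ n, Integrable (φ n) :=
    fun n => SimpleFunc.integrable_approxOn hv hi h0 (integrable_zero _ _ _) n
  have hφ1 : ∀ n x, ‖1 - φ n x‖ ≤ 1 := fun n x => SimpleFunc.approxOn_mem hv h0 n x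
  have hcl : ∀ᵐ x, v x ∈ closure s := Eventually.of_forall fun x => subset_closure (h1 x)
  have hlim : Tendsto (fun n => ∫ x, φ n x) atTop (𝓝 (∫ x, v x)) := by
    have := tendsto_integral_approxOn_of_measurable hi hv hcl h0 (integrable_zero _ _ _)
    refine this.congr fun n => ?_
    exact SimpleFunc.integral_eq_integral _ (hφi n)
  have hL1 : Tendsto (fun n => ∫⁻ x, ‖φ n x - v x‖ₑ) atTop (𝓝 0) :=
    SimpleFunc.tendsto_approxOn_L1_enorm hv h0 hcl (by simpa using hi.2)
  have hint : ∀ {w : Plane → ℂ}, Measurable w → Integrable w → (∀ x, ‖1 - w x‖ ≤ 1) →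
      Integrable (fun ω => ∏' m, (1 - w (X m ω))) P := by
    intro w hw hwi hw1
    refine Integrable.of_bound (hX.aestronglyMeasurable_tprod ha hw hwi) 1 ?_
    filter_upwards [hX.ae_multipliable ha hw hwi] with ω hω
    exact norm_tprod_le_one _ (fun m => hw1 _) hω
  have hconv : Tendsto (fun n => ∫ ω, ∏' m, (1 - φ n (X m ω)) ∂P) atTop
      (𝓝 (∫ ω, ∏' m, (1 - v (X m ω)) ∂P)) := by
    refine tendsto_integral_of_L1 _ (hint hv hi h1).1
      (Eventually.of_forall fun n => hint (φ n).measurable (hφi n) (hφ1 n)) ?_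
    have hz : Tendsto (fun n => ENNReal.ofReal a * ∫⁻ x, ‖φ n x - v x‖ₑ) atTop (𝓝 0) := by
      have := ENNReal.Tendsto.const_mul (a := ENNReal.ofReal a) hL1 (Or.inr ENNReal.ofReal_ne_top)
      simpa using this
    refine tendsto_of_tendsto_of_tendsto_of_le_of_le tendsto_const_nhds hz
      (fun _ => zero_le) fun n => ?_
    have hm : Measurable fun x => ‖φ n x - v x‖ₑ := ((φ n).measurable.sub hv).enorm
    change _ ≤ ENNReal.ofReal a * ∫⁻ x, ‖φ n x - v x‖ₑ
    -- Campbell's formula rewrites the deterministic `L¹` error as the expected sum of the errors at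
    -- the points, which dominates the difference of the two products.
    rw [← hX.lintegral_tsum_eq ha hm]
    refine lintegral_mono_ae ?_
    filter_upwards [hX.ae_multipliable ha hv hi,
      hX.ae_multipliable ha (φ n).measurable (hφi n)] with ω hω hω'
    refine (norm_tprod_sub_tprod_le _ _ (fun m => hφ1 n _) (fun m => h1 _) hω' hω).trans ?_
    refine ENNReal.tsum_le_tsum fun m => ?_
    rw [← enorm_neg]
    ring_nf
    exact le_rfl
  refine tendsto_nhds_unique hconv ?_
  simp_rw [hX.integral_tprod_simpleFunc ha _ (hφi _)]
  exact (Complex.continuous_exp.tendsto _).comp ((hlim.const_mul _).neg)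

end IsPoissonProcess

end PoissonProcess

/-! ### Laplace functionals of marked Poisson processes -/

/-- Mean value inequality on the left half-plane, where the derivative of `exp` has norm at most
one. -/
theorem norm_one_sub_exp_le {z : ℂ} (hz : z.re ≤ 0) : ‖1 - Complex.exp z‖ ≤ ‖z‖ := by
  have hc : Convex ℝ {w : ℂ | w.re ≤ 0} := convex_halfSpace_re_le 0
  have h := hc.norm_image_sub_le_of_norm_deriv_le (f := Complex.exp) (C := 1) (x := z) (y := 0)
    (fun x _ => Complex.differentiable_exp x) (fun x hx => by
      rw [Complex.deriv_exp, Complex.norm_exp]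
      exact Real.exp_le_one_iff.2 hx) hz (by simp)
  simpa using h

theorem norm_exp_neg_mul_le_one {s : ℂ} (hs : 0 ≤ s.re) {y : ℝ} (hy : 0 ≤ y) :
    ‖Complex.exp (-s * y)‖ ≤ 1 := by
  rw [Complex.norm_exp, Real.exp_le_one_iff]
  simpa using mul_nonneg hs hy

theorem norm_one_sub_exp_neg_mul_le {s : ℂ} (hs : 0 ≤ s.re) {y : ℝ} (hy : 0 ≤ y) :
    ‖1 - Complex.exp (-s * y)‖ ≤ ‖s‖ * y := by
  refine (norm_one_sub_exp_le (by simpa using mul_nonneg hs hy)).trans_eq ?_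
  simp [abs_of_nonneg hy]

section Marked

variable {Ω K : Type*} [MeasurableSpace Ω] [MeasurableSpace K] {P : Measure Ω}
  [IsProbabilityMeasure P] {ν : Measure K} [IsProbabilityMeasure ν] {a : ℝ}
  {X : ℕ → Ω → Plane} {M : ℕ → Ω → K} {f : Plane × K → ℝ}

/-- By linearity only the law of each single pair `(X m, M m)` matters, so independence among the
marks plays no role here. -/
theorem lintegral_tsum_marked (hX : IsPoissonProcess P a X) (ha : 0 ≤ a)
    (hM : ∀ m, Measurable (M m)) (hν : ∀ m, P.map (M m) = ν)
    (hXM : IndepFun (fun ω m => X m ω) (fun ω m => M m ω) P)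
    {u : Plane × K → ℝ≥0∞} (hu : Measurable u) :
    ∫⁻ ω, ∑' m, u (X m ω, M m ω) ∂P =
      ENNReal.ofReal a * ∫⁻ p, u p ∂((volume : Measure Plane).prod ν) := by
  have hpair : ∀ m, Measurable fun ω => (X m ω, M m ω) := fun m => (hX.1 m).prodMk (hM m)
  rw [lintegral_tsum (f := fun m ω => u (X m ω, M m ω)) fun m => (hu.comp (hpair m)).aemeasurable,
    lintegral_prod _ hu.aemeasurable,
    ← hX.lintegral_tsum_eq ha hu.lintegral_prod_right',
    lintegral_tsum (f := fun m ω => ∫⁻ k, u (X m ω, k) ∂ν)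
      fun m => (hu.lintegral_prod_right'.comp (hX.1 m)).aemeasurable]
  congr with m
  have hI : IndepFun (X m) (M m) P :=
    hXM.comp (φ := fun x : ℕ → Plane => x m) (ψ := fun x : ℕ → K => x m) (measurable_pi_apply m)
      (measurable_pi_apply m)
  rw [← lintegral_map hu (hpair m),
    hI.map_prod_eq_prod_map_map (hX.1 m).aemeasurable (hM m).aemeasurable, hν,
    lintegral_prod _ hu.aemeasurable, lintegral_map hu.lintegral_prod_right' (hX.1 m)]

theorem ae_summable_marked (hX : IsPoissonProcess P a X) (ha : 0 ≤ a)
    (hM : ∀ m, Measurable (M m)) (hν : ∀ m, P.map (M m) = ν)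
    (hXM : IndepFun (fun ω m => X m ω) (fun ω m => M m ω) P)
    (hf : Measurable f) (hi : Integrable f ((volume : Measure Plane).prod ν)) :
    ∀ᵐ ω ∂P, Summable fun m => f (X m ω, M m ω) := by
  have h := lintegral_tsum_marked hX ha hM hν hXM hf.enorm
  have hfin : ∫⁻ ω, ∑' m, ‖f (X m ω, M m ω)‖ₑ ∂P ≠ ∞ := by
    rw [h]
    exact ENNReal.mul_ne_top ENNReal.ofReal_ne_top hi.2.ne
  filter_upwards [ae_lt_top (Measurable.tsum fun m =>
    hf.enorm.comp ((hX.1 m).prodMk (hM m))) hfin] with ω hω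
  have := ENNReal.summable_toReal hω.ne
  exact Summable.of_norm (by simpa using this)

theorem integrable_tsum_marked (hX : IsPoissonProcess P a X) (ha : 0 ≤ a)
    (hM : ∀ m, Measurable (M m)) (hν : ∀ m, P.map (M m) = ν)
    (hXM : IndepFun (fun ω m => X m ω) (fun ω m => M m ω) P)
    (hf : Measurable f) (hi : Integrable f ((volume : Measure Plane).prod ν)) :
    Integrable (fun ω => ∑' m, f (X m ω, M m ω)) P := by
  refine ⟨(Measurable.tsum fun m => hf.comp ((hX.1 m).prodMk (hM m))).aestronglyMeasurable, ?_⟩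
  refine lt_of_le_of_lt (lintegral_mono fun ω => enorm_tsum_le_tsum_enorm) ?_
  rw [lintegral_tsum_marked hX ha hM hν hXM hf.enorm]
  exact ENNReal.mul_lt_top ENNReal.ofReal_lt_top hi.2

/-- With the points frozen, the factors depend on different independent marks, so the mark integral
of the product factorises. Working with finitely many factors avoids infinite products of integrals.
-/
theorem integral_prod_range_marked (hX : ∀ m, Measurable (X m))
    (hM : ∀ m, Measurable (M m)) (hν : ∀ m, P.map (M m) = ν) (hMi : iIndepFun M P)
    (hXM : IndepFun (fun ω m => X m ω) (fun ω m => M m ω) P)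
    {g : Plane × K → ℂ} (hg : Measurable g) (hg1 : ∀ p, ‖g p‖ ≤ 1) (n : ℕ) :
    ∫ ω, ∏ m ∈ Finset.range n, g (X m ω, M m ω) ∂P =
      ∫ ω, ∏ m ∈ Finset.range n, ∫ k, g (X m ω, k) ∂ν ∂P := by
  have hXs : Measurable fun ω m => X m ω := measurable_pi_lambda _ hX
  have hMs : Measurable fun ω m => M m ω := measurable_pi_lambda _ hM
  let F : (ℕ → Plane) × (ℕ → K) → ℂ := fun p => ∏ m ∈ Finset.range n, g (p.1 m, p.2 m)
  have hF : Measurable F := by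
    refine Finset.measurable_fun_prod _ fun m _ => hg.comp ?_
    exact ((measurable_pi_apply m).comp measurable_fst).prodMk
      ((measurable_pi_apply m).comp measurable_snd)
  have hF1 : ∀ p, ‖F p‖ ≤ 1 := fun p => by
    rw [norm_prod]
    exact Finset.prod_le_one (fun _ _ => norm_nonneg _) fun m _ => hg1 _
  have := Measure.isProbabilityMeasure_map (μ := P) hXs.aemeasurable
  have := Measure.isProbabilityMeasure_map (μ := P) hMs.aemeasurable
  calc ∫ ω, ∏ m ∈ Finset.range n, g (X m ω, M m ω) ∂P
      = ∫ p, F p ∂(P.map fun ω => ((fun m => X m ω), fun m => M m ω)) := by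
        rw [integral_map (hXs.prodMk hMs).aemeasurable hF.aestronglyMeasurable]
    _ = ∫ d, ∫ e, F (d, e) ∂(P.map fun ω m => M m ω) ∂(P.map fun ω m => X m ω) := by
        rw [hXM.map_prod_eq_prod_map_map hXs.aemeasurable hMs.aemeasurable,
          integral_prod _ (Integrable.of_bound hF.aestronglyMeasurable 1
            (Eventually.of_forall hF1))]
    _ = ∫ d, ∏ m ∈ Finset.range n, ∫ k, g (d m, k) ∂ν ∂(P.map fun ω m => X m ω) := by
        refine integral_congr_ae (Eventually.of_forall fun d => ?_)
        have hFd : Measurable fun e => F (d, e) := hF.comp measurable_prodMk_left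
        change ∫ e, F (d, e) ∂(P.map fun ω m => M m ω) = _
        rw [integral_map hMs.aemeasurable hFd.aestronglyMeasurable]
        simp only [F, Finset.prod_range]
        have hgd : ∀ m, Measurable fun k => g (d m, k) := fun m => hg.comp measurable_prodMk_left
        have hMn : iIndepFun (fun i : Fin n => M i) P := hMi.precomp Fin.val_injective
        rw [hMn.integral_fun_prod_comp
          (f := fun (i : Fin n) k => g (d i, k)) (fun i => (hM i).aemeasurable)
          fun i => (hgd i).aestronglyMeasurable]
        refine Finset.prod_congr rfl fun i _ => ?_
        rw [← hν i, integral_map (hM i).aemeasurable (hgd i).aestronglyMeasurable]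
    _ = _ := by
        have hm : Measurable fun x => ∫ k, g (x, k) ∂ν :=
          (hg.stronglyMeasurable.integral_prod_right').measurable
        have hm' : Measurable fun d : ℕ → Plane =>
            ∏ m ∈ Finset.range n, ∫ k, g (d m, k) ∂ν :=
          Finset.measurable_fun_prod _ fun m _ => hm.comp (measurable_pi_apply m)
        rw [integral_map hXs.aemeasurable hm'.aestronglyMeasurable]

/-- The Laplace functional of a Poisson process with independent marks. -/
theorem integral_exp_neg_tsum_marked (hX : IsPoissonProcess P a X) (ha : 0 ≤ a)
    (hM : ∀ m, Measurable (M m)) (hν : ∀ m, P.map (M m) = ν) (hMi : iIndepFun M P)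
    (hXM : IndepFun (fun ω m => X m ω) (fun ω m => M m ω) P)
    (hf : Measurable f) (hi : Integrable f ((volume : Measure Plane).prod ν))
    (hf0 : ∀ p, 0 ≤ f p) {s : ℂ} (hs : 0 ≤ s.re) :
    ∫ ω, Complex.exp (-s * (∑' m, f (X m ω, M m ω) : ℝ)) ∂P =
      Complex.exp (-(a * ∫ p, (1 - Complex.exp (-s * f p)) ∂((volume : Measure Plane).prod ν))) := by
  have hg : Measurable fun p => Complex.exp (-s * f p) := by fun_prop
  have hg1 : ∀ p, ‖Complex.exp (-s * f p)‖ ≤ 1 := fun p => norm_exp_neg_mul_le_one hs (hf0 p)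
  have hvi : Integrable (fun p => 1 - Complex.exp (-s * f p)) ((volume : Measure Plane).prod ν) := by
    refine (hi.const_mul ‖s‖).mono' (hg.const_sub 1).aestronglyMeasurable ?_
    exact Eventually.of_forall fun p => norm_one_sub_exp_neg_mul_le hs (hf0 p)
  -- After the marks are averaged, `1 - v x` is the mean factor contributed by a point at `x`; the
  -- unmarked generating functional applies to `v`.
  let v : Plane → ℂ := fun x => ∫ k, (1 - Complex.exp (-s * f (x, k))) ∂ν
  have hv : Measurable v :=
    ((hg.const_sub 1).stronglyMeasurable.integral_prod_right').measurable
  have hv' : Integrable v := hvi.integral_prod_left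
  have hv1 : ∀ x, 1 - v x = ∫ k, Complex.exp (-s * f (x, k)) ∂ν := fun x => by
    have : Integrable (fun k => Complex.exp (-s * f (x, k))) ν :=
      Integrable.of_bound (hg.comp measurable_prodMk_left).aestronglyMeasurable 1
        (Eventually.of_forall fun k => hg1 _)
    simp only [v]
    rw [integral_sub (integrable_const _) this]
    simp
  have hvn : ∀ x, ‖1 - v x‖ ≤ 1 := fun x => by
    rw [hv1]
    refine (norm_integral_le_of_norm_le_const (Eventually.of_forall fun k => hg1 _)).trans_eq ?_
    simp
  rw [integral_prod _ hvi, ← hX.integral_tprod ha hv hv' hvn]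
  have hlim1 : Tendsto
      (fun n => ∫ ω, ∏ m ∈ Finset.range n, Complex.exp (-s * f (X m ω, M m ω)) ∂P) atTop
      (𝓝 (∫ ω, Complex.exp (-s * (∑' m, f (X m ω, M m ω) : ℝ)) ∂P)) := by
    refine tendsto_integral_of_dominated_convergence (fun _ => 1) (fun n => ?_)
      (integrable_const _) (fun n => Eventually.of_forall fun ω => ?_) ?_
    · exact (Finset.measurable_fun_prod _ fun m _ =>
        hg.comp ((hX.1 m).prodMk (hM m))).aestronglyMeasurable
    · rw [norm_prod]
      exact Finset.prod_le_one (fun _ _ => norm_nonneg _) fun m _ => hg1 _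
    · filter_upwards [ae_summable_marked hX ha hM hν hXM hf hi] with ω hω
      simp_rw [← Complex.exp_sum, ← Finset.mul_sum, ← Complex.ofReal_sum]
      refine (Complex.continuous_exp.tendsto _).comp (Tendsto.const_mul _ ?_)
      exact (Complex.continuous_ofReal.tendsto _).comp hω.hasSum.tendsto_sum_nat
  refine tendsto_nhds_unique hlim1 ?_
  -- The same truncated expectations are read a second time, now with averaged marks, and tend to
  -- the expectation of the infinite product.
  simp_rw [integral_prod_range_marked hX.1 hM hν hMi hXM hg hg1, ← hv1]
  refine tendsto_integral_of_dominated_convergence (fun _ => 1) (fun n => ?_)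
    (integrable_const _) (fun n => Eventually.of_forall fun ω => ?_) ?_
  · exact (Finset.measurable_fun_prod _ fun m _ =>
      (hv.comp (hX.1 m)).const_sub 1).aestronglyMeasurable
  · rw [norm_prod]
    exact Finset.prod_le_one (fun _ _ => norm_nonneg _) fun m _ => hvn _
  · filter_upwards [hX.ae_multipliable ha hv hv'] with ω hω
    exact hω.hasProd.tendsto_prod_nat

end Marked

/-! ### Gil-Pelaez inversion -/

section GilPelaez

theorem integral_exp_neg_mul_cexp {ε : ℝ} (hε : 0 < ε) (u : ℝ) :
    ∫ t in Ioi (0 : ℝ), (Real.exp (-ε * t) : ℂ) * Complex.exp (Complex.I * t * u) =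
      1 / (ε - Complex.I * u) := by
  have h := integral_exp_mul_complex_Ioi (a := -(ε - Complex.I * u)) (by simpa using hε) 0
  simp only [Complex.ofReal_zero, mul_zero, Complex.exp_zero] at h
  rw [neg_div_neg_eq] at h
  rw [← h]
  congr with t
  rw [Complex.ofReal_exp, ← Complex.exp_add]
  push_cast
  ring_nf

theorem integrableOn_exp_neg_mul {ε : ℝ} (hε : 0 < ε) :
    IntegrableOn (fun t => Real.exp (-ε * t)) (Ioi 0) := exp_neg_integrableOn_Ioi 0 hε

theorem integral_exp_neg_mul_cos {ε : ℝ} (hε : 0 < ε) (u : ℝ) :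
    ∫ t in Ioi (0 : ℝ), Real.exp (-ε * t) * Real.cos (t * u) = ε / (ε ^ 2 + u ^ 2) := by
  have hi : Integrable (fun t : ℝ => (Real.exp (-ε * t) : ℂ) * Complex.exp (Complex.I * t * u))
      (volume.restrict (Ioi 0)) := by
    refine (integrableOn_exp_neg_mul hε).mono' (by fun_prop) (Eventually.of_forall fun t => ?_)
    have : Complex.I * t * u = ((t * u : ℝ) : ℂ) * Complex.I := by push_cast; ring
    rw [norm_mul, this, Complex.norm_exp_ofReal_mul_I, mul_one, Complex.norm_real, Real.norm_eq_abs,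
      abs_of_pos (Real.exp_pos _)]
  have h := congrArg Complex.re (integral_exp_neg_mul_cexp hε u)
  rw [← Complex.reCLM_apply, ← ContinuousLinearMap.integral_comp_comm _ hi] at h
  convert h using 1
  · congr with t
    have : Complex.I * t * u = ((t * u : ℝ) : ℂ) * Complex.I := by push_cast; ring
    rw [Complex.reCLM_apply, Complex.re_ofReal_mul, this, Complex.exp_ofReal_mul_I_re]
  · simp [Complex.normSq_apply]
    ring

/-- Write `sin (t u) / t` as the integral of `cos (t v)` over `v` from `0` to `u` and exchange the
integrals; the factor `exp (-ε t)` makes Fubini legitimate. What remains is the primitive of `ε /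
(ε² + v²)`. -/
theorem integral_exp_neg_mul_sin_div {ε : ℝ} (hε : 0 < ε) (u : ℝ) :
    ∫ t in Ioi (0 : ℝ), Real.exp (-ε * t) * (1 / t * Real.sin (t * u)) = Real.arctan (u / ε) := by
  have h1 : ∀ t ∈ Ioi (0 : ℝ), Real.exp (-ε * t) * (1 / t * Real.sin (t * u)) =
      ∫ v in (0 : ℝ)..u, Real.exp (-ε * t) * Real.cos (t * v) := by
    intro t ht
    have ht0 : t ≠ 0 := (mem_Ioi.1 ht).ne'
    rw [intervalIntegral.integral_const_mul, intervalIntegral.integral_comp_mul_left _ ht0]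
    simp
  rw [setIntegral_congr_fun measurableSet_Ioi h1]
  have : IsFiniteMeasure (volume.restrict (uIoc 0 u)) :=
    ⟨by simp [uIoc_eq_union]⟩
  have hi : Integrable (Function.uncurry fun (t v : ℝ) => Real.exp (-ε * t) * Real.cos (t * v))
      ((volume.restrict (Ioi 0)).prod (volume.restrict (uIoc 0 u))) := by
    have := (integrableOn_exp_neg_mul hε).mul_prod
      (integrable_const (μ := volume.restrict (uIoc 0 u)) (1 : ℝ))
    refine this.mono' (by fun_prop) (Eventually.of_forall fun p => ?_)
    simp only [Function.uncurry, norm_mul, Real.norm_eq_abs, abs_of_pos (Real.exp_pos _)]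
    gcongr
    exact Real.abs_cos_le_one _
  rw [← intervalIntegral_integral_swap
    (f := fun v t => Real.exp (-ε * t) * Real.cos (t * v)) hi.swap]
  simp_rw [integral_exp_neg_mul_cos hε]
  simp [integral_div_sq_add_sq]

variable (μ : Measure ℝ) [IsProbabilityMeasure μ]

omit [IsProbabilityMeasure μ] in
theorem charFun_mul_exp_eq (x t : ℝ) :
    Complex.exp (-Complex.I * t * x) * charFun μ t =
      ∫ y, Complex.exp (Complex.I * t * (y - x : ℝ)) ∂μ := by
  rw [charFun_apply_real, ← integral_const_mul]
  congr with y
  rw [← Complex.exp_add]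
  push_cast
  ring_nf

theorem norm_exp_I_mul_mul (t u : ℝ) : ‖Complex.exp (Complex.I * t * u)‖ = 1 := by
  have : Complex.I * t * u = ((t * u : ℝ) : ℂ) * Complex.I := by push_cast; ring
  rw [this, Complex.norm_exp_ofReal_mul_I]

theorem im_charFun_mul_exp_eq (x t : ℝ) :
    (Complex.exp (-Complex.I * t * x) * charFun μ t).im = ∫ y, Real.sin (t * (y - x)) ∂μ := by
  have hi : Integrable (fun y : ℝ => Complex.exp (Complex.I * t * (y - x : ℝ))) μ :=
    Integrable.of_bound (by fun_prop) 1
      (Eventually.of_forall fun y => (norm_exp_I_mul_mul t (y - x)).le)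
  rw [charFun_mul_exp_eq, ← Complex.imCLM_apply, ← ContinuousLinearMap.integral_comp_comm _ hi]
  congr with y
  have : Complex.I * t * (y - x : ℝ) = ((t * (y - x) : ℝ) : ℂ) * Complex.I := by push_cast; ring
  rw [Complex.imCLM_apply, this, Complex.exp_ofReal_mul_I_im]

/-- A probability measure with integrable characteristic function has no atoms. -/
theorem measure_singleton_eq_zero_of_integrableOn_charFun
    (hφ : IntegrableOn (charFun μ) (Ioi 0)) (x : ℝ) : μ {x} = 0 := by
  let ε : ℕ → ℝ := fun n => 1 / ((n : ℝ) + 1)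
  have hε : ∀ n, 0 < ε n := fun n => by positivity
  have hε0 : Tendsto ε atTop (𝓝 0) := tendsto_one_div_add_atTop_nhds_zero_nat
  -- The right-hand kernel equals `1` at `y = x` and tends to `0` elsewhere, so its limit is the
  -- mass of `{x}`. On the left, integrability of the characteristic function makes the prefactor `ε
  -- n` win.
  have key : ∀ n, ε n * ∫ t in Ioi (0 : ℝ), (Real.exp (-ε n * t) : ℂ) *
      (Complex.exp (-Complex.I * t * x) * charFun μ t) =
      ∫ y, (ε n : ℂ) / (ε n - Complex.I * (y - x : ℝ)) ∂μ := by
    intro n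
    simp_rw [charFun_mul_exp_eq, ← integral_const_mul]
    have hi : Integrable (Function.uncurry fun (t y : ℝ) =>
        (ε n : ℂ) * ((Real.exp (-ε n * t) : ℂ) * Complex.exp (Complex.I * t * (y - x : ℝ))))
        ((volume.restrict (Ioi 0)).prod μ) := by
      have := ((integrableOn_exp_neg_mul (hε n)).const_mul (ε n)).mul_prod
        (integrable_const (μ := μ) (1 : ℝ))
      refine this.mono' (by fun_prop) (Eventually.of_forall fun p => ?_)
      simp only [Function.uncurry, norm_mul, norm_exp_I_mul_mul, Complex.norm_real,
        Real.norm_eq_abs, abs_of_pos (Real.exp_pos _), abs_of_pos (hε n)]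
      simp
    rw [integral_integral_swap hi]
    congr with y
    rw [integral_const_mul, integral_exp_neg_mul_cexp (hε n)]
    ring
  have h1 : Tendsto (fun n => ∫ y, (ε n : ℂ) / (ε n - Complex.I * (y - x : ℝ)) ∂μ) atTop
      (𝓝 (∫ y, ({x} : Set ℝ).indicator (fun _ => (1 : ℂ)) y ∂μ)) := by
    refine tendsto_integral_of_dominated_convergence (fun _ => 1) (fun n => ?_)
      (integrable_const _) (fun n => Eventually.of_forall fun y => ?_)
      (Eventually.of_forall fun y => ?_)
    · have : Measurable fun y : ℝ => (ε n : ℂ) / (ε n - Complex.I * (y - x : ℝ)) := by fun_prop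
      exact this.aestronglyMeasurable
    · rw [norm_div]
      refine div_le_one_of_le₀ ?_ (norm_nonneg _)
      refine le_trans ?_ (Complex.abs_re_le_norm _)
      simp
    · by_cases hy : y = x
      · subst hy
        have : ∀ n, (ε n : ℂ) ≠ 0 := fun n => by exact_mod_cast (hε n).ne'
        simp [this]
      · rw [indicator_of_notMem (by simpa using hy)]
        have hd : (0 : ℂ) - Complex.I * (y - x : ℝ) ≠ 0 := by
          simpa [sub_eq_zero, ← Complex.ofReal_sub] using hy
        have hc : Tendsto (fun n => (ε n : ℂ)) atTop (𝓝 0) := by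
          simpa [Function.comp_def] using (Complex.continuous_ofReal.tendsto 0).comp hε0
        simpa [Pi.div_def] using hc.div (hc.sub_const (Complex.I * (y - x : ℝ))) hd
  have h2 : Tendsto (fun n => ∫ y, (ε n : ℂ) / (ε n - Complex.I * (y - x : ℝ)) ∂μ) atTop (𝓝 0) := by
    have hz : Tendsto (fun n => ε n * ∫ t in Ioi (0 : ℝ), ‖charFun μ t‖) atTop (𝓝 0) := by
      simpa using hε0.mul_const (∫ t in Ioi (0 : ℝ), ‖charFun μ t‖)
    refine squeeze_zero_norm (fun n => ?_) hz
    rw [← key, norm_mul, Complex.norm_real, Real.norm_eq_abs, abs_of_pos (hε n)]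
    refine mul_le_mul_of_nonneg_left ?_ (hε n).le
    refine norm_integral_le_of_norm_le hφ.norm ?_
    filter_upwards [ae_restrict_mem measurableSet_Ioi] with t ht
    have : -Complex.I * t * x = Complex.I * t * (-x : ℝ) := by push_cast; ring
    rw [norm_mul, norm_mul, this, norm_exp_I_mul_mul, one_mul, Complex.norm_real, Real.norm_eq_abs,
      abs_of_pos (Real.exp_pos _)]
    refine mul_le_of_le_one_left (norm_nonneg _) (Real.exp_le_one_iff.2 ?_)
    nlinarith [hε n, mem_Ioi.1 ht]
  have h3 := tendsto_nhds_unique h1 h2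
  rw [integral_indicator_const _ (measurableSet_singleton x)] at h3
  simpa [Measure.real, ENNReal.toReal_eq_zero_iff] using h3

/-- Near zero, `|sin (t (y - x))| / t ≤ |y - x|`, which the first moment integrates. Beyond `1` the
factor `1 / t` is at most one and the characteristic function is integrable. -/
theorem integrableOn_gilPelaez (hμ : Integrable id μ) (hφ : IntegrableOn (charFun μ) (Ioi 0))
    (x : ℝ) :
    IntegrableOn (fun t : ℝ => 1 / t * (Complex.exp (-Complex.I * t * x) * charFun μ t).im)
      (Ioi 0) := by
  have hm : Measurable fun t : ℝ =>
      1 / t * (Complex.exp (-Complex.I * t * x) * charFun μ t).im := by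
    have : Measurable (charFun μ) := measurable_charFun
    fun_prop
  rw [← Ioc_union_Ioi_eq_Ioi (zero_le_one' ℝ)]
  refine IntegrableOn.union ?_ ?_
  · refine Measure.integrableOn_of_bounded (M := ∫ y, |y - x| ∂μ) (by simp)
      hm.aestronglyMeasurable ?_
    filter_upwards [ae_restrict_mem measurableSet_Ioc] with t ht
    have hμx : Integrable (fun y => |y - x|) μ := (hμ.sub (integrable_const x)).abs
    rw [im_charFun_mul_exp_eq, ← integral_const_mul]
    refine norm_integral_le_of_norm_le hμx (Eventually.of_forall fun y => ?_)
    rw [norm_mul, Real.norm_eq_abs, Real.norm_eq_abs, abs_of_pos (by simpa using ht.1)]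
    have h := Real.abs_sin_le_abs (x := t * (y - x))
    rw [abs_mul, abs_of_pos ht.1] at h
    rw [one_div, inv_mul_le_iff₀ ht.1]
    exact h
  · refine (hφ.mono_set (Ioi_subset_Ioi zero_le_one)).norm.mono' hm.aestronglyMeasurable ?_
    filter_upwards [ae_restrict_mem measurableSet_Ioi] with t ht
    have ht' : (1 : ℝ) < t := ht
    rw [norm_mul, Real.norm_eq_abs, abs_of_pos (by positivity)]
    refine (mul_le_of_le_one_left (norm_nonneg _) ?_).trans
      ((Complex.abs_im_le_norm _).trans_eq ?_)
    · rw [one_div]; exact inv_le_one_of_one_le₀ ht'.le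
    · have : -Complex.I * t * x = Complex.I * t * (-x : ℝ) := by push_cast; ring
      rw [norm_mul, this, norm_exp_I_mul_mul, one_mul]

/-- The Gil-Pelaez inversion formula. -/
theorem measureReal_Iic_eq_gilPelaez (hμ : Integrable id μ)
    (hφ : IntegrableOn (charFun μ) (Ioi 0)) (x : ℝ) :
    μ.real (Iic x) = 1 / 2 - 1 / Real.pi * ∫ t in Ioi (0 : ℝ),
      1 / t * (Complex.exp (-Complex.I * t * x) * charFun μ t).im := by
  let ε : ℕ → ℝ := fun n => 1 / ((n : ℝ) + 1)
  have hε : ∀ n, 0 < ε n := fun n => by positivity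
  have hε0 : Tendsto ε atTop (𝓝 0) := tendsto_one_div_add_atTop_nhds_zero_nat
  have hint := integrableOn_gilPelaez μ hμ hφ x
  -- Abel regularisation replaces the conditionally convergent Dirichlet integral by an arctangent,
  -- which is a bounded smoothing of `(π / 2) sign (y - x)`.
  have key : ∀ n, ∫ t in Ioi (0 : ℝ), Real.exp (-ε n * t) *
      (1 / t * (Complex.exp (-Complex.I * t * x) * charFun μ t).im) =
      ∫ y, Real.arctan ((y - x) / ε n) ∂μ := by
    intro n
    simp_rw [im_charFun_mul_exp_eq, ← integral_const_mul]
    have hi : Integrable (Function.uncurry fun (t y : ℝ) =>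
        Real.exp (-ε n * t) * (1 / t * Real.sin (t * (y - x))))
        ((volume.restrict (Ioi 0)).prod μ) := by
      have := (integrableOn_exp_neg_mul (hε n)).mul_prod (hμ.sub (integrable_const x)).abs
      have hm : Measurable (Function.uncurry fun (t y : ℝ) =>
        Real.exp (-ε n * t) * (1 / t * Real.sin (t * (y - x)))) := by
        unfold Function.uncurry; fun_prop
      refine this.mono' hm.aestronglyMeasurable (Eventually.of_forall fun p => ?_)
      simp only [Function.uncurry, norm_mul, Real.norm_eq_abs, abs_of_pos (Real.exp_pos _)]
      refine mul_le_mul_of_nonneg_left ?_ (Real.exp_pos _).le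
      have h := Real.abs_sin_le_abs (x := p.1 * (p.2 - x))
      rw [abs_mul p.1] at h
      rw [abs_div, abs_one, one_div]
      exact inv_mul_le_of_le_mul₀ (abs_nonneg _) (abs_nonneg _) h
    rw [integral_integral_swap hi]
    congr with y
    exact integral_exp_neg_mul_sin_div (hε n) _
  have h1 : Tendsto (fun n => ∫ t in Ioi (0 : ℝ), Real.exp (-ε n * t) *
      (1 / t * (Complex.exp (-Complex.I * t * x) * charFun μ t).im)) atTop
      (𝓝 (∫ t in Ioi (0 : ℝ),
        1 / t * (Complex.exp (-Complex.I * t * x) * charFun μ t).im)) := by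
    refine tendsto_integral_of_dominated_convergence _ (fun n => ?_) hint.norm (fun n => ?_) ?_
    · exact (by fun_prop : Continuous fun t => Real.exp (-ε n * t)).aestronglyMeasurable.mul hint.1
    · filter_upwards [ae_restrict_mem measurableSet_Ioi] with t ht
      rw [norm_mul, Real.norm_eq_abs, abs_of_pos (Real.exp_pos _)]
      refine mul_le_of_le_one_left (norm_nonneg _) (Real.exp_le_one_iff.2 ?_)
      nlinarith [hε n, mem_Ioi.1 ht]
    · refine Eventually.of_forall fun t => ?_
      have : Tendsto (fun n => Real.exp (-ε n * t)) atTop (𝓝 1) := by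
        have h := (Real.continuous_exp.tendsto _).comp (hε0.neg.mul_const t)
        simpa [Function.comp_def] using h
      simpa using this.mul_const
        (1 / t * (Complex.exp (-Complex.I * t * x) * charFun μ t).im)
  have h2 : Tendsto (fun n => ∫ y, Real.arctan ((y - x) / ε n) ∂μ) atTop
      (𝓝 (∫ y, (Real.pi / 2 - (Iic x).indicator (fun _ => Real.pi) y) ∂μ)) := by
    refine tendsto_integral_of_dominated_convergence (fun _ => Real.pi / 2) (fun n => ?_)
      (integrable_const _) (fun n => Eventually.of_forall fun y => ?_) ?_
    · have : Measurable fun y : ℝ => Real.arctan ((y - x) / ε n) := by fun_prop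
      exact this.aestronglyMeasurable
    · exact abs_le.2 ⟨(Real.neg_pi_div_two_lt_arctan _).le, (Real.arctan_lt_pi_div_two _).le⟩
    -- At `y = x` the arctangents are all `0` while the claimed limit is `-π / 2`; absence of atoms
    -- makes this point negligible.
    · have hne : ∀ᵐ y ∂μ, y ≠ x := by
        simpa [ae_iff] using measure_singleton_eq_zero_of_integrableOn_charFun μ hφ x
      have hdiv : ∀ u : ℝ, (fun n => u / ε n) = fun n : ℕ => u * ((n : ℝ) + 1) := by
        intro u; ext n; simp [ε]
      have hN : Tendsto (fun n : ℕ => (n : ℝ) + 1) atTop atTop :=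
        tendsto_atTop_add_const_right _ _ tendsto_natCast_atTop_atTop
      filter_upwards [hne] with y hy
      rcases lt_or_gt_of_ne hy with h | h
      · rw [indicator_of_mem (by exact h.le)]
        have ht : Tendsto (fun n => (y - x) / ε n) atTop atBot := by
          rw [hdiv]; exact hN.const_mul_atTop_of_neg (sub_neg.2 h)
        have := (Real.tendsto_arctan_atBot.mono_right nhdsWithin_le_nhds).comp ht
        rw [show Real.pi / 2 - Real.pi = -(Real.pi / 2) by ring]
        exact this
      · rw [indicator_of_notMem (by simpa using h), sub_zero]
        have ht : Tendsto (fun n => (y - x) / ε n) atTop atTop := by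
          rw [hdiv]; exact hN.const_mul_atTop (sub_pos.2 h)
        exact (Real.tendsto_arctan_atTop.mono_right nhdsWithin_le_nhds).comp ht
  simp_rw [key] at h1
  rw [tendsto_nhds_unique h1 h2, integral_sub (integrable_const _)
    ((integrable_const _).indicator measurableSet_Iic),
    integral_indicator_const _ measurableSet_Iic]
  simp
  field_simp
  ring

end GilPelaez

/-! ### Exponential, Gamma and nearest-distance laws -/

/-- The value of the density at `0` is irrelevant. Restricting to the open half-line and taking an
`NNReal`-valued density prepares for the `withDensity` integral formulas. -/
theorem withDensity_gammaPDF_eq (a r : ℝ) : gammaMeasure a r =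
    (volume.restrict (Ioi 0)).withDensity fun x =>
      ((r ^ a / Real.Gamma a * x ^ (a - 1) * Real.exp (-(r * x))).toNNReal : ℝ≥0∞) := by
  rw [gammaMeasure, ← withDensity_indicator measurableSet_Ioi]
  refine withDensity_congr_ae ?_
  filter_upwards [Measure.ae_ne volume (0 : ℝ)] with x hx
  rcases lt_or_gt_of_ne hx with h | h
  · rw [gammaPDF_of_neg h, indicator_of_notMem (by simpa using h.le)]
  · rw [gammaPDF_of_nonneg h.le, indicator_of_mem (by exact h)]
    rfl

theorem integral_gammaMeasure {E : Type*} [NormedAddCommGroup E] [NormedSpace ℝ E] {a r : ℝ}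
    (ha : 0 < a) (hr : 0 < r) (f : ℝ → E) :
    ∫ x, f x ∂(gammaMeasure a r) = ∫ x in Ioi (0 : ℝ),
      (r ^ a / Real.Gamma a * x ^ (a - 1) * Real.exp (-(r * x))) • f x := by
  have hG := Real.Gamma_pos_of_pos ha
  rw [withDensity_gammaPDF_eq, integral_withDensity_eq_integral_smul (by fun_prop)]
  refine setIntegral_congr_fun measurableSet_Ioi fun x hx => ?_
  have hx' : (0 : ℝ) < x := hx
  simp only [NNReal.smul_def]
  rw [Real.coe_toNNReal _ (by positivity)]

theorem integrable_id_gammaMeasure {a r : ℝ} (ha : 0 < a) (hr : 0 < r) :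
    Integrable (fun x => x) (gammaMeasure a r) := by
  have hG := Real.Gamma_pos_of_pos ha
  rw [withDensity_gammaPDF_eq, integrable_withDensity_iff_integrable_smul (by fun_prop)]
  have h := (integrableOn_rpow_mul_exp_neg_mul_rpow (s := a) (p := 1) (b := r)
    (by linarith) one_pos hr).const_mul (r ^ a / Real.Gamma a)
  refine IntegrableOn.congr_fun h (fun x hx => ?_) measurableSet_Ioi
  have hx' : (0 : ℝ) < x := hx
  simp only [NNReal.smul_def]
  rw [Real.coe_toNNReal _ (by positivity), Real.rpow_sub_one hx'.ne', Real.rpow_one]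
  simp only [smul_eq_mul]
  field_simp

theorem ae_nonneg_gammaMeasure (a r : ℝ) : ∀ᵐ x ∂(gammaMeasure a r), 0 ≤ x := by
  rw [withDensity_gammaPDF_eq]
  refine (withDensity_absolutelyContinuous _ _).ae_le ?_
  filter_upwards [ae_restrict_mem measurableSet_Ioi] with x hx using le_of_lt hx

theorem integrable_exp_mul_gammaMeasure {a r : ℝ} (ha : 0 < a) (hr : 0 < r) {t : ℝ}
    (ht : t < r) : Integrable (fun x => Real.exp (t * x)) (gammaMeasure a r) := by
  have hG := Real.Gamma_pos_of_pos ha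
  rw [withDensity_gammaPDF_eq, integrable_withDensity_iff_integrable_smul (by fun_prop)]
  have h := (integrableOn_rpow_mul_exp_neg_mul_rpow (s := a - 1) (p := 1) (b := r - t)
    (by linarith) one_pos (sub_pos.2 ht)).const_mul (r ^ a / Real.Gamma a)
  refine IntegrableOn.congr_fun h (fun x hx => ?_) measurableSet_Ioi
  have hx' : (0 : ℝ) < x := hx
  simp only [NNReal.smul_def]
  rw [Real.coe_toNNReal _ (by positivity), Real.rpow_one, smul_eq_mul, mul_assoc _ (Real.exp _),
    ← Real.exp_add]
  ring_nf

theorem complexMGF_gammaMeasure_ofReal {a r : ℝ} (ha : 0 < a) (hr : 0 < r) {t : ℝ}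
    (ht : t < r) :
    complexMGF id (gammaMeasure a r) t = 1 / (1 - (t : ℂ) / r) ^ (a : ℂ) := by
  have hG := Real.Gamma_pos_of_pos ha
  have hpos : 0 < 1 - t / r := by rw [sub_pos, div_lt_one hr]; exact ht
  have h := Real.integral_rpow_mul_exp_neg_mul_Ioi ha (sub_pos.2 ht)
  rw [complexMGF_ofReal, mgf, integral_gammaMeasure ha hr]
  have hcongr : ∀ x ∈ Ioi (0 : ℝ),
      (r ^ a / Real.Gamma a * x ^ (a - 1) * Real.exp (-(r * x))) • Real.exp (t * id x) =
      (r ^ a / Real.Gamma a) * (x ^ (a - 1) * Real.exp (-((r - t) * x))) := by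
    intro x _
    rw [smul_eq_mul, id, show -((r - t) * x) = -(r * x) + t * x by ring, Real.exp_add]
    ring
  rw [setIntegral_congr_fun measurableSet_Ioi hcongr, integral_const_mul, h,
    show r - t = r * (1 - t / r) by field_simp, one_div, Real.inv_rpow (by positivity),
    Real.mul_rpow hr.le hpos.le]
  have : r ^ a ≠ 0 := (Real.rpow_pos_of_pos hr a).ne'
  have h1 : (1 : ℂ) - t / r = ((1 - t / r : ℝ) : ℂ) := by push_cast; ring
  rw [h1, ← Complex.ofReal_cpow hpos.le]
  have : (1 - t / r) ^ a ≠ 0 := (Real.rpow_pos_of_pos hpos a).ne'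
  rw [one_div, ← Complex.ofReal_inv]
  congr 1
  field_simp

/-- The Laplace transform of a Gamma distribution. -/
theorem integral_exp_neg_mul_gammaMeasure {a r : ℝ} (ha : 0 < a) (hr : 0 < r) {w : ℂ}
    (hw : 0 ≤ w.re) :
    ∫ x, Complex.exp (-w * x) ∂(gammaMeasure a r) = 1 / (1 + w / r) ^ (a : ℂ) := by
  -- On this convex half-plane `1 - z / r` has positive real part, so the principal power is
  -- analytic and the identity theorem applies.
  let U : Set ℂ := {z | z.re < r}
  have hU : Convex ℝ U := convex_halfSpace_re_lt r
  have hUo : IsOpen U := isOpen_Iio.preimage Complex.continuous_re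
  have hexp : Iio r ⊆ integrableExpSet id (gammaMeasure a r) := fun t ht =>
    integrable_exp_mul_gammaMeasure ha hr ht
  have hf : AnalyticOnNhd ℂ (complexMGF id (gammaMeasure a r)) U := fun z hz =>
    analyticAt_complexMGF (interior_mono hexp (by rw [interior_Iio]; exact hz))
  have hre : ∀ z ∈ U, 0 < (1 - z / r).re := by
    intro z hz
    rw [Complex.sub_re, Complex.one_re, Complex.div_ofReal_re, sub_pos, div_lt_one hr]
    exact hz
  have hg : AnalyticOnNhd ℂ (fun z : ℂ => 1 / (1 - z / r) ^ (a : ℂ)) U := by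
    refine DifferentiableOn.analyticOnNhd (fun z hz => ?_) hUo
    have hs : 1 - z / r ∈ Complex.slitPlane := Or.inl (hre z hz)
    have hne : (1 - z / r) ^ (a : ℂ) ≠ 0 := by
      rw [Ne, Complex.cpow_eq_zero_iff, not_and_or]
      exact Or.inl (Complex.slitPlane_ne_zero hs)
    refine DifferentiableAt.differentiableWithinAt ?_
    exact (differentiableAt_const _).div
      (DifferentiableAt.cpow_const (by fun_prop) hs) hne
  -- The real axis accumulates at `0`, and there the identity is the real Gamma integral.
  have hfreq : ∃ᶠ z in 𝓝[≠] (0 : ℂ),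
      complexMGF id (gammaMeasure a r) z = 1 / (1 - z / r) ^ (a : ℂ) := by
    have ht : Tendsto (fun t : ℝ => (t : ℂ)) (𝓝[≠] 0) (𝓝[≠] 0) := by
      refine tendsto_nhdsWithin_iff.2 ⟨?_, ?_⟩
      · simpa using (Complex.continuous_ofReal.tendsto 0).mono_left nhdsWithin_le_nhds
      · filter_upwards [self_mem_nhdsWithin] with t ht
        simpa using ht
    refine ht.frequently (Eventually.frequently ?_)
    filter_upwards [nhdsWithin_le_nhds (Iio_mem_nhds hr)] with t ht
    exact complexMGF_gammaMeasure_ofReal ha hr ht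
  have h := hf.eqOn_of_preconnected_of_frequently_eq hg hU.isPreconnected
    (z₀ := 0) (by simpa [U] using hr) hfreq (x := -w) (by simp [U]; linarith)
  simpa [complexMGF, neg_div] using h

theorem integral_ite_lt_expMeasure {E : Type*} [NormedAddCommGroup E] [NormedSpace ℝ E] {τ : ℝ}
    (hτ : 0 ≤ τ) (F : ℝ → E) :
    ∫ h, (if τ < h then F h else 0) ∂(expMeasure 1) =
      ∫ h in Ioi τ, Real.exp (-h) • F h := by
  rw [expMeasure, integral_gammaMeasure one_pos one_pos]
  have : ∀ h : ℝ, ((1 : ℝ) ^ (1 : ℝ) / Real.Gamma 1 * h ^ ((1 : ℝ) - 1) * Real.exp (-(1 * h))) •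
      (if τ < h then F h else 0) = (Ioi τ).indicator (fun h => Real.exp (-h) • F h) h := by
    intro h
    by_cases hh : τ < h <;> simp [hh]
  simp_rw [this]
  rw [setIntegral_indicator measurableSet_Ioi, inter_eq_self_of_subset_right (Ioi_subset_Ioi hτ)]

theorem expMeasure_Ioi {u : ℝ} (hu : 0 ≤ u) : (expMeasure 1).real (Ioi u) = Real.exp (-u) := by
  have h := integral_ite_lt_expMeasure hu fun _ => (1 : ℝ)
  have h1 : (fun h : ℝ => if u < h then (1 : ℝ) else 0) = (Ioi u).indicator fun _ => 1 := by
    ext h; simp [indicator]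
  rw [h1, integral_indicator_const _ measurableSet_Ioi] at h
  simp only [smul_eq_mul, mul_one] at h
  rw [h, integral_exp_neg_Ioi]

/-- The Laplace transform of an exponential variable above a threshold. -/
theorem integral_ite_lt_one_sub_exp_expMeasure {τ : ℝ} (hτ : 0 ≤ τ) {w : ℂ} (hw : 0 ≤ w.re) :
    ∫ h, (if τ < h then 1 - Complex.exp (-w * h) else 0) ∂(expMeasure 1) =
      Real.exp (-τ) * (1 - Complex.exp (-τ * w) / (w + 1)) := by
  rw [integral_ite_lt_expMeasure hτ]
  have h1 : ∀ h : ℝ, Real.exp (-h) • (1 - Complex.exp (-w * h)) =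
      Complex.exp ((-1 : ℂ) * h) - Complex.exp (-(w + 1) * h) := by
    intro h
    rw [Complex.real_smul, mul_sub, Complex.ofReal_exp, ← Complex.exp_add]
    push_cast
    ring_nf
  have hre : (-(w + 1)).re < 0 := by simp; linarith
  have hne : w + 1 ≠ 0 := fun h => by simp [h] at hre
  simp_rw [h1]
  rw [integral_sub (integrableOn_exp_mul_complex_Ioi (by simp) _)
    (integrableOn_exp_mul_complex_Ioi hre _), integral_exp_mul_complex_Ioi (by simp),
    integral_exp_mul_complex_Ioi hre, Complex.ofReal_exp, mul_sub, ← mul_div_assoc,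
    ← Complex.exp_add]
  push_cast
  rw [neg_div_neg_eq, neg_div_neg_eq]
  ring_nf

theorem isProbabilityMeasure_uniformOn_fin {nZ : ℕ} (z₀ : Fin nZ) :
    IsProbabilityMeasure (uniformOn (Set.univ : Set (Fin nZ))) :=
  have : Nonempty (Fin nZ) := ⟨z₀⟩
  isProbabilityMeasure_uniformOn finite_univ univ_nonempty

theorem integral_ite_eq_uniformOn {nZ : ℕ} (z₀ : Fin nZ) (c : ℂ) :
    ∫ z, (if z = z₀ then c else 0) ∂(uniformOn (Set.univ : Set (Fin nZ))) = c / nZ := by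
  have h : (fun z => if z = z₀ then c else 0) = ({z₀} : Set (Fin nZ)).indicator fun _ => c := by
    ext z; simp [indicator]
  rw [h, integral_indicator_const _ (measurableSet_singleton _), Measure.real, uniformOn_univ]
  simp
  ring

/-- The law of the channel gain and the code of a device. -/
noncomputable abbrev gainCodeLaw (nZ : ℕ) : Measure (ℝ × Fin nZ) := (expMeasure 1).prod (uniformOn Set.univ)

theorem integral_ite_gainCodeLaw {nZ : ℕ} (z₀ : Fin nZ) {τ : ℝ} (hτ : 0 ≤ τ) {w : ℂ}
    (hw : 0 ≤ w.re) :
    ∫ q, (if τ < q.1 ∧ q.2 = z₀ then 1 - Complex.exp (-w * q.1) else 0) ∂(gainCodeLaw nZ) =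
      Real.exp (-τ) / nZ * (1 - Complex.exp (-τ * w) / (w + 1)) := by
  have := isProbabilityMeasure_uniformOn_fin z₀
  have := isProbabilityMeasure_expMeasure one_pos
  have hm : Measurable fun q : ℝ × Fin nZ =>
      if τ < q.1 ∧ q.2 = z₀ then 1 - Complex.exp (-w * q.1) else 0 := by
    refine Measurable.ite ?_ (by fun_prop) measurable_const
    exact (measurableSet_lt measurable_const measurable_fst).inter
      (measurable_snd (measurableSet_singleton z₀))
  have hi : Integrable (fun q : ℝ × Fin nZ =>
      if τ < q.1 ∧ q.2 = z₀ then 1 - Complex.exp (-w * q.1) else 0) (gainCodeLaw nZ) := by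
    refine Integrable.of_bound hm.aestronglyMeasurable 2 (Eventually.of_forall fun q => ?_)
    split_ifs with hq
    · refine (norm_sub_le _ _).trans ?_
      have := norm_exp_neg_mul_le_one hw (hτ.trans hq.1.le)
      simp only [norm_one]
      linarith
    · simp
  rw [integral_prod _ hi]
  have h1 : ∀ h : ℝ, ∫ z, (if τ < h ∧ z = z₀ then 1 - Complex.exp (-w * h) else 0)
      ∂(uniformOn (Set.univ : Set (Fin nZ))) =
      (if τ < h then 1 - Complex.exp (-w * h) else 0) / nZ := by
    intro h
    by_cases hh : τ < h
    · simp only [hh, true_and, if_true]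
      exact integral_ite_eq_uniformOn z₀ _
    · simp [hh]
  simp_rw [h1]
  rw [integral_div, integral_ite_lt_one_sub_exp_expMeasure hτ hw]
  ring

theorem integrable_fst_gainCodeLaw {nZ : ℕ} (z₀ : Fin nZ) :
    Integrable (fun q => q.1) (gainCodeLaw nZ) := by
  have := isProbabilityMeasure_uniformOn_fin z₀
  have := isProbabilityMeasure_expMeasure one_pos
  exact (integrable_id_gammaMeasure one_pos one_pos).comp_fst _

section NearestDist

variable {Ω : Type*} [MeasurableSpace Ω] {P : Measure Ω} {a : ℝ} {X : ℕ → Ω → Plane}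

omit [MeasurableSpace Ω] in
theorem bddBelow_range_norm (X : ℕ → Ω → Plane) (ω : Ω) :
    BddBelow (range fun m => ‖X m ω‖) := ⟨0, by rintro _ ⟨m, rfl⟩; exact norm_nonneg _⟩

omit [MeasurableSpace Ω] in
theorem nearestDist_nonneg (X : ℕ → Ω → Plane) (ω : Ω) : 0 ≤ nearestDist X ω :=
  Real.iInf_nonneg fun _ => norm_nonneg _

theorem measurable_nearestDist (hX : ∀ m, Measurable (X m)) : Measurable (nearestDist X) :=
  Measurable.iInf fun m => (hX m).norm

/-- The layer-cake formula needs `P(R² ≥ t)`, which is the probability that the ball of radius `√t`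
contains no point, namely `exp (-π a t)`. -/
theorem lintegral_nearestDist_sq (hX : IsPoissonProcess P a X) (ha : 0 < a) :
    ∫⁻ ω, ENNReal.ofReal (nearestDist X ω ^ 2) ∂P = ENNReal.ofReal (1 / (Real.pi * a)) := by
  rw [lintegral_eq_lintegral_meas_le P (Eventually.of_forall fun ω => sq_nonneg _)
    ((measurable_nearestDist hX.1).pow_const 2).aemeasurable]
  have h1 : ∀ t ∈ Ioi (0 : ℝ), P {ω | t ≤ nearestDist X ω ^ 2} =
      ENNReal.ofReal (Real.exp (-(Real.pi * a) * t)) := by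
    intro t ht
    have ht' : 0 < t := ht
    have hset : {ω | t ≤ nearestDist X ω ^ 2} =
        {ω | {m | X m ω ∈ Metric.ball (0 : Plane) (√t)}.encard = ((0 : ℕ) : ℕ∞)} := by
      ext ω
      simp only [mem_ofPred_eq, Nat.cast_zero, encard_eq_zero, eq_empty_iff_forall_notMem,
        mem_ball_zero_iff, not_lt]
      rw [← Real.sqrt_le_left (nearestDist_nonneg X ω), nearestDist, le_ciInf_iff (bddBelow_range_norm X ω)]
    rw [hset, hX.measure_encard measurableSet_ball measure_ball_lt_top.ne,
      poissonMeasure_singleton, EuclideanSpace.volume_ball_fin_two]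
    congr 1
    have harea : (ENNReal.ofReal √t ^ 2 * ENNReal.ofReal Real.pi).toReal = Real.pi * t := by
      rw [← ENNReal.ofReal_pow (Real.sqrt_nonneg _), Real.sq_sqrt ht'.le, ENNReal.toReal_mul,
        ENNReal.toReal_ofReal ht'.le]
      rw [ENNReal.toReal_ofReal Real.pi_pos.le, mul_comm]
    rw [harea, Real.coe_toNNReal _ (by positivity)]
    simp
    ring
  rw [setLIntegral_congr_fun measurableSet_Ioi h1, ← ofReal_integral_eq_lintegral_ofReal]
  · rw [integral_exp_mul_Ioi (neg_lt_zero.2 (by positivity))]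
    simp
  · exact exp_neg_integrableOn_Ioi 0 (by positivity)
  · exact Eventually.of_forall fun t => (Real.exp_pos _).le

end NearestDist

/-! ### Inter-cell interference -/

/-- One minus the Laplace transform of the gain of a cluster head, as a function of the mean
received power. -/
noncomputable def gainDefect (τ : ℝ) (w : ℂ) : ℂ := 1 - Complex.exp (-τ * w) / (w + 1)

theorem gainDefect_zero (τ : ℝ) : gainDefect τ 0 = 0 := by simp [gainDefect]

theorem one_le_norm_add_one {w : ℂ} (hw : 0 ≤ w.re) : 1 ≤ ‖w + 1‖ := by
  refine le_trans ?_ (Complex.re_le_norm _)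
  simpa using hw

/-- Linear decay at small received power: together with `η > 2` this makes the radial integral
converge at infinity. -/
theorem norm_gainDefect_le {τ : ℝ} (hτ : 0 ≤ τ) {w : ℂ} (hw : 0 ≤ w.re) :
    ‖gainDefect τ w‖ ≤ (1 + τ) * ‖w‖ := by
  have h1 := one_le_norm_add_one hw
  have hne : w + 1 ≠ 0 := fun h => by simp [h] at h1; linarith
  have h2 : gainDefect τ w = (w + (1 - Complex.exp (-τ * w))) / (w + 1) := by
    rw [gainDefect]; field_simp; ring
  have h3 : ‖1 - Complex.exp (-τ * w)‖ ≤ τ * ‖w‖ := by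
    refine (norm_one_sub_exp_le ?_).trans_eq ?_
    · simpa using mul_nonneg hτ hw
    · simp [abs_of_nonneg hτ]
  rw [h2, norm_div]
  refine (div_le_self (norm_nonneg _) h1).trans ((norm_add_le _ _).trans ?_)
  linarith

theorem norm_one_sub_gainDefect_le {τ : ℝ} (hτ : 0 ≤ τ) {w : ℂ} (hw : 0 ≤ w.re) :
    ‖1 - gainDefect τ w‖ ≤ 1 / ‖w + 1‖ := by
  rw [gainDefect, sub_sub_cancel, norm_div]
  refine div_le_div_of_nonneg_right ?_ (norm_nonneg _)
  rw [Complex.norm_exp, Real.exp_le_one_iff]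
  simpa using mul_nonneg hτ hw

theorem measurable_gainDefect (τ : ℝ) : Measurable (gainDefect τ) := by
  unfold gainDefect; fun_prop

theorem integrableOn_gainDefect {τ η : ℝ} (hτ : 0 ≤ τ) (hη : 2 < η) {s : ℂ} (hs : 0 ≤ s.re) :
    IntegrableOn (fun r : ℝ => gainDefect τ (s * (r ^ (-η) : ℝ)) * r) (Ioi 1) := by
  have h := (integrableOn_Ioi_rpow_of_lt (a := 1 - η) (by linarith) one_pos).const_mul
    ((1 + τ) * ‖s‖)
  refine Integrable.mono' h ?_ ?_
  · have : Measurable fun r : ℝ => gainDefect τ (s * (r ^ (-η) : ℝ)) * r :=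
      ((measurable_gainDefect τ).comp (by fun_prop)).mul (by fun_prop)
    exact this.aestronglyMeasurable
  · filter_upwards [ae_restrict_mem measurableSet_Ioi] with r hr
    have hr0 : (0 : ℝ) < r := one_pos.trans hr
    have hp : 0 ≤ r ^ (-η) := by positivity
    have h1 := norm_gainDefect_le (w := s * (r ^ (-η) : ℝ)) hτ (by
      rw [Complex.re_mul_ofReal]; positivity)
    rw [norm_mul, Complex.norm_real, Real.norm_eq_abs, abs_of_pos hr0]
    refine (mul_le_mul_of_nonneg_right h1 hr0.le).trans_eq ?_
    rw [norm_mul, Complex.norm_real, Real.norm_eq_abs, abs_of_nonneg hp, sub_eq_neg_add,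
      Real.rpow_add_one hr0.ne']
    ring

/-- The scaling of distances in the exponent of the inter-cell Laplace transform. -/
theorem rpow_mul_integral_gainDefect (τ : ℝ) {η ρ : ℝ} (hη : 0 < η) (hρ : 0 < ρ) (s : ℂ) :
    (ρ ^ (2 / η) : ℝ) * ∫ y in Ioi (ρ ^ (-1 / η)), gainDefect τ (s * (y ^ (-η) : ℝ)) * y =
      ∫ r in Ioi (1 : ℝ), gainDefect τ (s * ρ * (r ^ (-η) : ℝ)) * r := by
  set b : ℝ := ρ ^ (1 / η) with hb
  have hb0 : 0 < b := Real.rpow_pos_of_pos hρ _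
  have hba : b * ρ ^ (-1 / η) = 1 := by
    rw [hb, ← Real.rpow_add hρ, neg_div, add_neg_cancel, Real.rpow_zero]
  have hb2 : ρ ^ (2 / η) = b * b := by
    rw [hb, ← Real.rpow_add hρ]; ring_nf
  have hbη : b ^ (-η) = ρ⁻¹ := by
    rw [hb, ← Real.rpow_mul hρ.le, ← Real.rpow_neg_one]
    congr 1
    field_simp
  have h := integral_comp_mul_left_Ioi
    (fun r : ℝ => gainDefect τ (s * ρ * (r ^ (-η) : ℝ)) * r) (ρ ^ (-1 / η)) hb0
  rw [hba] at h
  have hc : ∀ y ∈ Ioi (ρ ^ (-1 / η)),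
      gainDefect τ (s * ρ * ((b * y) ^ (-η) : ℝ)) * ((b * y : ℝ) : ℂ) =
      b * (gainDefect τ (s * (y ^ (-η) : ℝ)) * y) := by
    intro y hy
    have hy0 : 0 < y := (Real.rpow_pos_of_pos hρ _).trans hy
    have hρc : (ρ : ℂ) ≠ 0 := by exact_mod_cast hρ.ne'
    rw [Real.mul_rpow hb0.le hy0.le, hbη]
    have : s * ρ * ((ρ⁻¹ * y ^ (-η) : ℝ) : ℂ) = s * (y ^ (-η) : ℝ) := by
      push_cast; field_simp
    rw [this]
    push_cast
    ring
  rw [setIntegral_congr_fun measurableSet_Ioi hc, integral_const_mul, Complex.real_smul] at h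
  have hbc : (b : ℂ) ≠ 0 := by exact_mod_cast hb0.ne'
  rw [hb2]
  push_cast at h ⊢
  rw [mul_assoc, h]
  field_simp

theorem interLaplace_eq (K τ : ℝ) {η ρ : ℝ} (hη : 0 < η) (hρ : 0 < ρ) (s : ℂ) :
    interLaplace K η ρ τ s = Complex.exp
      (-(2 * K * ∫ r in Ioi (1 : ℝ), gainDefect τ (s * ρ * (r ^ (-η) : ℝ)) * r)) := by
  rw [interLaplace, ← rpow_mul_integral_gainDefect τ hη hρ s]
  simp only [gainDefect, mul_assoc]

/-- For `v ≥ 1`, `‖1 - iv‖ ≥ √2 ≥ 4 / 3`, hence the transform of the gain has norm at most `3 / 4`.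
-/
theorem quarter_le_re_gainDefect {τ : ℝ} (hτ : 0 ≤ τ) {v : ℝ} (hv : 1 ≤ v) :
    1 / 4 ≤ (gainDefect τ (-Complex.I * v)).re := by
  have h := norm_one_sub_gainDefect_le (w := -Complex.I * v) hτ (by simp)
  have h1 : 4 / 3 ≤ ‖-Complex.I * v + 1‖ := by
    refine abs_le_of_sq_le_sq' ?_ (norm_nonneg _) |>.2
    rw [← Complex.normSq_eq_norm_sq, Complex.normSq_apply]
    simp
    nlinarith
  have h2 : 1 / ‖-Complex.I * v + 1‖ ≤ 3 / 4 := by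
    rw [div_le_iff₀ (by linarith)]; linarith
  have h3 := (Complex.re_le_norm _).trans (h.trans h2)
  simp only [Complex.sub_re, Complex.one_re] at h3
  linarith

theorem re_gainDefect_nonneg {τ : ℝ} (hτ : 0 ≤ τ) {w : ℂ} (hw : 0 ≤ w.re) :
    0 ≤ (gainDefect τ w).re := by
  have h := norm_one_sub_gainDefect_le hτ hw
  have h1 : 1 / ‖w + 1‖ ≤ 1 := by
    have := one_le_norm_add_one hw
    rw [div_le_iff₀ (by linarith)]; linarith
  have h3 := (Complex.re_le_norm _).trans (h.trans h1)
  simp only [Complex.sub_re, Complex.one_re] at h3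
  linarith

/-- Growth of the exponent along the imaginary axis. For `1 < r ≤ b = (tρ)^(1/η)` the received power
times `t` is at least one, so the integrand has real part at least `r / 4`; integrating up to `b`
gives `(b² - 1) / 8`. -/
theorem le_re_integral_gainDefect {τ η ρ : ℝ} (hτ : 0 ≤ τ) (hη : 2 < η) (hρ : 0 < ρ) {t : ℝ}
    (ht : 0 < t) :
    ((t * ρ) ^ (2 / η) - 1) / 8 ≤
      (∫ r in Ioi (1 : ℝ), gainDefect τ (-Complex.I * t * ρ * (r ^ (-η) : ℝ)) * r).re := by
  have hre : ∀ r : ℝ, (gainDefect τ (-Complex.I * t * ρ * (r ^ (-η) : ℝ)) * r).re =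
      (gainDefect τ (-Complex.I * (t * ρ * r ^ (-η) : ℝ))).re * r := by
    intro r
    rw [Complex.re_mul_ofReal]
    push_cast
    ring_nf
  have hi := integrableOn_gainDefect hτ hη (s := -Complex.I * t * ρ) (by simp)
  have hi' := hi.re
  rw [← Complex.reCLM_apply, ← ContinuousLinearMap.integral_comp_comm _ hi]
  simp only [Complex.reCLM_apply, hre]
  simp only [RCLike.re_to_complex, hre] at hi'
  have hnn : ∀ r ∈ Ioi (1 : ℝ), 0 ≤ (gainDefect τ (-Complex.I * (t * ρ * r ^ (-η) : ℝ))).re * r :=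
    fun r hr => mul_nonneg (re_gainDefect_nonneg hτ (by simp)) (one_pos.trans hr).le
  set b : ℝ := (t * ρ) ^ (1 / η) with hb
  have htρ : 0 < t * ρ := by positivity
  have hb0 : 0 < b := Real.rpow_pos_of_pos htρ _
  have hb2 : (t * ρ) ^ (2 / η) = b ^ 2 := by
    rw [hb, sq, ← Real.rpow_add htρ]; ring_nf
  have hbη : b ^ (-η) = (t * ρ)⁻¹ := by
    rw [hb, ← Real.rpow_mul htρ.le, ← Real.rpow_neg_one]
    congr 1
    field_simp
  rw [hb2]
  -- If `b ≤ 1` the claimed lower bound is nonpositive and positivity of the integrand suffices.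
  rcases le_total b 1 with h1 | h1
  · refine le_trans ?_ (setIntegral_nonneg measurableSet_Ioi hnn)
    nlinarith
  · have hsub : Ioc 1 b ⊆ Ioi 1 := Ioc_subset_Ioi_self
    refine le_trans ?_ (setIntegral_mono_set hi' (ae_restrict_of_forall_mem measurableSet_Ioi hnn)
      (ae_of_all _ hsub))
    have hquad : (b ^ 2 - 1) / 8 = ∫ r in Ioc 1 b, 1 / 4 * r := by
      rw [← intervalIntegral.integral_of_le h1, intervalIntegral.integral_const_mul, integral_id]
      ring
    rw [hquad]
    refine setIntegral_mono_on ?_ (IntegrableOn.mono_set hi' hsub) measurableSet_Ioc fun r hr => ?_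
    · exact (by fun_prop : Continuous fun r : ℝ => 1 / 4 * r).integrableOn_Ioc
    · have hr0 : 0 < r := one_pos.trans hr.1
      refine mul_le_mul_of_nonneg_right (quarter_le_re_gainDefect hτ ?_) hr0.le
      have h2 : b ^ (-η) ≤ r ^ (-η) :=
        Real.rpow_le_rpow_of_nonpos hr0 hr.2 (by linarith)
      rw [hbη] at h2
      calc (1 : ℝ) = t * ρ * (t * ρ)⁻¹ := (mul_inv_cancel₀ htρ.ne').symm
        _ ≤ _ := by gcongr

/-- The inter-cell Laplace transform is integrable along the imaginary axis. -/
theorem integrableOn_exp_bound {K η ρ : ℝ} (hK : 0 < K) (hη : 2 < η) (hρ : 0 < ρ) :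
    IntegrableOn (fun t : ℝ => Real.exp (-(2 * K * (((t * ρ) ^ (2 / η) - 1) / 8)))) (Ioi 0) := by
  have h := (integrableOn_rpow_mul_exp_neg_mul_rpow (s := 0) (p := 2 / η)
    (b := K / 4 * ρ ^ (2 / η)) (by norm_num) (by positivity) (by positivity)).const_mul
      (Real.exp (K / 4))
  refine IntegrableOn.congr_fun h (fun t ht => ?_) measurableSet_Ioi
  have ht0 : (0 : ℝ) < t := ht
  simp only [Real.rpow_zero, one_mul]
  rw [← Real.exp_add, Real.mul_rpow ht0.le hρ.le]
  ring_nf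

theorem norm_interLaplace_le {K τ η ρ : ℝ} (hK : 0 ≤ K) (hτ : 0 ≤ τ) (hη : 2 < η) (hρ : 0 < ρ)
    {t : ℝ} (ht : 0 < t) :
    ‖interLaplace K η ρ τ (-Complex.I * t)‖ ≤
      Real.exp (-(2 * K * (((t * ρ) ^ (2 / η) - 1) / 8))) := by
  rw [interLaplace_eq K τ (by linarith) hρ, Complex.norm_exp, Real.exp_le_exp, Complex.neg_re,
    neg_le_neg_iff]
  have h : (2 : ℂ) * K = ((2 * K : ℝ) : ℂ) := by push_cast; ring
  rw [h, Complex.re_ofReal_mul]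
  exact mul_le_mul_of_nonneg_left (le_re_integral_gainDefect hτ hη hρ ht) (by positivity)

/-- Path gain outside the unit disc. -/
noncomputable def outerGain (η : ℝ) (x : Plane) : ℝ := if 1 < ‖x‖ then ‖x‖ ^ (-η) else 0

theorem outerGain_nonneg (η : ℝ) (x : Plane) : 0 ≤ outerGain η x := by
  unfold outerGain; split_ifs <;> positivity

theorem outerGain_zero (η : ℝ) : outerGain η 0 = 0 := by simp [outerGain]

theorem measurable_outerGain (η : ℝ) : Measurable (outerGain η) :=
  Measurable.ite (measurableSet_lt measurable_const measurable_norm) (by fun_prop)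
    measurable_const

theorem integrable_outerGain {η : ℝ} (hη : 2 < η) : Integrable (outerGain η) := by
  have h := (integrable_one_add_norm (E := Plane) (μ := volume) (r := η)
    (by simpa using hη)).const_mul (2 ^ η)
  refine h.mono' (measurable_outerGain η).aestronglyMeasurable (Eventually.of_forall fun x => ?_)
  rw [Real.norm_eq_abs, abs_of_nonneg (outerGain_nonneg η x), outerGain]
  split_ifs with hx
  · have hx0 : 0 < ‖x‖ := one_pos.trans hx
    have h1 : (2 * ‖x‖) ^ (-η) ≤ (1 + ‖x‖) ^ (-η) :=
      Real.rpow_le_rpow_of_nonpos (by positivity) (by linarith) (by linarith)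
    rw [Real.mul_rpow zero_le_two hx0.le, Real.rpow_neg zero_le_two] at h1
    have h2 : (0 : ℝ) < 2 ^ η := by positivity
    rwa [inv_mul_le_iff₀ h2] at h1
  · positivity

/-- Also valid for `R = 0`: a constant over the plane has Bochner integral `0`, being zero or not
integrable. -/
theorem integral_comp_inv_smul_plane {E : Type*} [NormedAddCommGroup E] [NormedSpace ℝ E]
    (F : Plane → E) (R : ℝ) : ∫ x, F (R⁻¹ • x) = R ^ 2 • ∫ x, F x := by
  rw [Measure.integral_comp_inv_smul]
  simp

theorem integral_gainDefect_outerGain (τ η : ℝ) (s : ℂ) :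
    ∫ x : Plane, gainDefect τ (s * outerGain η x) =
      2 * Real.pi * ∫ r in Ioi (1 : ℝ), gainDefect τ (s * (r ^ (-η) : ℝ)) * r := by
  have h := integral_fun_norm_addHaar (volume : Measure Plane)
    (fun r : ℝ => gainDefect τ (s * ((if 1 < r then r ^ (-η) else 0 : ℝ) : ℂ)))
  have hball : (volume : Measure Plane).real (Metric.ball 0 1) = Real.pi := by
    rw [Measure.real, EuclideanSpace.volume_ball_fin_two]
    simp [Real.pi_pos.le]
  rw [hball] at h
  unfold outerGain
  rw [h, finrank_euclideanSpace_fin]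
  have hind : ∀ r : ℝ, (r ^ (2 - 1)) • gainDefect τ (s * ((if 1 < r then r ^ (-η) else 0 : ℝ) : ℂ)) =
      (Ioi (1 : ℝ)).indicator (fun r => gainDefect τ (s * (r ^ (-η) : ℝ)) * r) r := by
    intro r
    by_cases hr : 1 < r
    · simp [hr, mul_comm]
    · simp [hr, gainDefect_zero]
  simp_rw [hind]
  rw [setIntegral_indicator measurableSet_Ioi,
    inter_eq_self_of_subset_right (Ioi_subset_Ioi zero_le_one)]
  simp [mul_assoc]

open Classical in
/-- Contribution to the inter-cell interference of a device at `p.1` with service distance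
`p.2.1`, gain `p.2.2.1` and code `p.2.2.2`. -/
noncomputable def markedGain (η ρ τ : ℝ) {nZ : ℕ} (z₀ : Fin nZ)
    (p : Plane × (ℝ × (ℝ × Fin nZ))) : ℝ :=
  if τ < p.2.2.1 ∧ p.2.2.2 = z₀ then ρ * outerGain η (p.2.1⁻¹ • p.1) * p.2.2.1 else 0

section MarkedGain

variable {η ρ τ : ℝ} {nZ : ℕ} {z₀ : Fin nZ}

theorem markedGain_nonneg (hρ : 0 < ρ) (hτ : 0 ≤ τ) (p : Plane × (ℝ × (ℝ × Fin nZ))) :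
    0 ≤ markedGain η ρ τ z₀ p := by
  unfold markedGain
  split_ifs with h
  · exact mul_nonneg (mul_nonneg hρ.le (outerGain_nonneg _ _)) (hτ.trans h.1.le)
  · exact le_rfl

theorem measurable_markedGain : Measurable (markedGain η ρ τ z₀) := by
  refine Measurable.ite ?_ ?_ measurable_const
  · exact (measurableSet_lt measurable_const
      (by fun_prop : Measurable fun p : Plane × (ℝ × (ℝ × Fin nZ)) => p.2.2.1)).inter
      ((by fun_prop : Measurable fun p : Plane × (ℝ × (ℝ × Fin nZ)) => p.2.2.2)
        (measurableSet_singleton z₀))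
  · have h : Measurable fun p : Plane × (ℝ × (ℝ × Fin nZ)) => outerGain η (p.2.1⁻¹ • p.1) :=
      (measurable_outerGain η).comp (by fun_prop)
    fun_prop

variable {νR : Measure ℝ} [IsProbabilityMeasure νR]

/-- For fixed `R` the plane integral scales like `R²`, so a second moment of the service distance is
exactly what is used. -/
theorem integrable_outerGain_smul (hη : 2 < η) (hR : Integrable (fun R => R ^ 2) νR) :
    Integrable (fun p : Plane × ℝ => outerGain η (p.2⁻¹ • p.1)) ((volume : Measure Plane).prod νR) := by
  have hm : Measurable fun p : Plane × ℝ => outerGain η (p.2⁻¹ • p.1) :=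
    (measurable_outerGain η).comp (by fun_prop)
  rw [integrable_prod_iff' hm.aestronglyMeasurable]
  refine ⟨Eventually.of_forall fun R => ?_, ?_⟩
  · by_cases hR0 : R = 0
    · simp [hR0, outerGain_zero]
    · have h : Integrable (fun x => outerGain η (R⁻¹ • x)) :=
        (integrable_comp_smul_iff volume (outerGain η) (inv_ne_zero hR0)).2
          (integrable_outerGain hη)
      exact h
  · simp_rw [integral_comp_inv_smul_plane fun x => ‖outerGain η x‖]
    exact hR.smul_const _

theorem integrable_markedGain (hη : 2 < η) (hR : Integrable (fun R => R ^ 2) νR) :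
    Integrable (markedGain η ρ τ z₀) ((volume : Measure Plane).prod (νR.prod (gainCodeLaw nZ))) := by
  have := isProbabilityMeasure_uniformOn_fin z₀
  have := isProbabilityMeasure_expMeasure one_pos
  have hmp := measurePreserving_prodAssoc (volume : Measure Plane) νR (gainCodeLaw nZ)
  rw [← hmp.integrable_comp_emb (MeasurableEquiv.measurableEmbedding _)]
  have h := ((integrable_outerGain_smul hη hR).const_mul ρ).mul_prod
    (integrable_fst_gainCodeLaw z₀)
  refine h.norm.mono' (measurable_markedGain.comp
    (MeasurableEquiv.measurable _)).aestronglyMeasurable (Eventually.of_forall fun p => ?_)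
  simp only [Function.comp_apply, MeasurableEquiv.prodAssoc, MeasurableEquiv.coe_mk,
    Equiv.prodAssoc_apply, markedGain]
  split_ifs
  · exact le_rfl
  · rw [norm_zero]
    exact norm_nonneg _

theorem integral_one_sub_exp_markedGain (hη : 2 < η) (hρ : 0 < ρ) (hτ : 0 ≤ τ)
    (hR : Integrable (fun R => R ^ 2) νR) {s : ℂ} (hs : 0 ≤ s.re) :
    ∫ p, (1 - Complex.exp (-s * markedGain η ρ τ z₀ p))
      ∂((volume : Measure Plane).prod (νR.prod (gainCodeLaw nZ))) =
    Real.exp (-τ) / nZ * ((∫ R, R ^ 2 ∂νR : ℝ) * (2 * Real.pi *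
      ∫ r in Ioi (1 : ℝ), gainDefect τ (s * ρ * (r ^ (-η) : ℝ)) * r)) := by
  have := isProbabilityMeasure_uniformOn_fin z₀
  have := isProbabilityMeasure_expMeasure one_pos
  have hmp := measurePreserving_prodAssoc (volume : Measure Plane) νR (gainCodeLaw nZ)
  have hm := measurable_markedGain (η := η) (ρ := ρ) (τ := τ) (z₀ := z₀)
  have hi : Integrable (fun p => 1 - Complex.exp (-s * markedGain η ρ τ z₀ p))
      ((volume : Measure Plane).prod (νR.prod (gainCodeLaw nZ))) := by
    refine ((integrable_markedGain (ρ := ρ) (τ := τ) (z₀ := z₀) hη hR).const_mul ‖s‖).mono'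
      (by fun_prop) ?_
    exact Eventually.of_forall fun p =>
      norm_one_sub_exp_neg_mul_le hs (markedGain_nonneg hρ hτ p)
  rw [← hmp.integrable_comp_emb (MeasurableEquiv.measurableEmbedding _)] at hi
  rw [← hmp.integral_comp (MeasurableEquiv.measurableEmbedding _)]
  -- Gain and code are averaged first: the code gives `1 / nZ` and the thresholded exponential gain
  -- gives `e^{-τ}` times the defect at mean power `ρ * outerGain`.
  have hq : ∀ p : Plane × ℝ, ∫ q, (1 - Complex.exp (-s * markedGain η ρ τ z₀
      (MeasurableEquiv.prodAssoc (p, q)))) ∂(gainCodeLaw nZ) =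
      Real.exp (-τ) / nZ * gainDefect τ (s * ρ * outerGain η (p.2⁻¹ • p.1)) := by
    intro p
    have hw : 0 ≤ (s * ρ * outerGain η (p.2⁻¹ • p.1)).re := by
      rw [Complex.re_mul_ofReal, Complex.re_mul_ofReal]
      exact mul_nonneg (mul_nonneg hs hρ.le) (outerGain_nonneg _ _)
    rw [gainDefect, ← integral_ite_gainCodeLaw z₀ hτ hw]
    refine integral_congr_ae (Eventually.of_forall fun q => ?_)
    simp only [MeasurableEquiv.prodAssoc, MeasurableEquiv.coe_mk, Equiv.prodAssoc_apply, markedGain]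
    by_cases h : τ < q.1 ∧ q.2 = z₀
    · simp only [h, and_self, if_true]
      push_cast
      ring_nf
    · simp [h]
  have hi2 := hi.integral_prod_left
  simp only [Function.comp_def] at hi hi2
  rw [integral_prod _ hi]
  simp_rw [hq] at hi2 ⊢
  -- The plane is integrated before `R`, so that scaling by `R` pulls out `R²` and leaves an
  -- integral independent of `R`.
  rw [integral_prod_symm _ hi2]
  simp_rw [integral_const_mul]
  congr 1
  simp_rw [integral_comp_inv_smul_plane fun x => gainDefect τ (s * ρ * outerGain η x),
    integral_gainDefect_outerGain]
  rw [integral_smul_const, Complex.real_smul]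

end MarkedGain

namespace Network

variable {Ω : Type*} [MeasurableSpace Ω] {P : Measure Ω} [IsProbabilityMeasure P]
  {lam mu : ℝ} {nZ : ℕ} {η ρ τ : ℝ} {z₀ : Fin nZ} (N : Network P lam mu nZ)

theorem isProbabilityMeasure_map_nearestDist : IsProbabilityMeasure (P.map (nearestDist N.bs)) :=
  Measure.isProbabilityMeasure_map (measurable_nearestDist N.bs_poisson.1).aemeasurable

omit [IsProbabilityMeasure P] in
theorem integrable_sq_serviceDist (hlam : 0 < lam) :
    Integrable (fun R => R ^ 2) (P.map (nearestDist N.bs)) := by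
  have hm := measurable_nearestDist N.bs_poisson.1
  rw [integrable_map_measure (by fun_prop) hm.aemeasurable]
  refine ⟨(hm.pow_const 2).aestronglyMeasurable, ?_⟩
  change HasFiniteIntegral (fun ω => nearestDist N.bs ω ^ 2) P
  rw [hasFiniteIntegral_iff_ofReal (Eventually.of_forall fun ω => sq_nonneg _),
    lintegral_nearestDist_sq N.bs_poisson hlam]
  exact ENNReal.ofReal_lt_top

omit [IsProbabilityMeasure P] in
theorem integral_sq_serviceDist (hlam : 0 < lam) :
    ∫ R, R ^ 2 ∂(P.map (nearestDist N.bs)) = 1 / (Real.pi * lam) := by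
  have hm := measurable_nearestDist N.bs_poisson.1
  rw [integral_map hm.aemeasurable (by fun_prop), integral_eq_lintegral_of_nonneg_ae
    (Eventually.of_forall fun ω => sq_nonneg _) (hm.pow_const 2).aestronglyMeasurable,
    lintegral_nearestDist_sq N.bs_poisson hlam, ENNReal.toReal_ofReal (by positivity)]

theorem ae_dev_ne_zero (hmu : 0 < mu) : ∀ᵐ ω ∂P, ∀ m, N.dev m ω ≠ 0 := by
  rw [ae_all_iff]
  intro m
  have h : P.map (N.dev m) {0} = 0 := by
    refine le_antisymm ?_ zero_le
    refine (Measure.le_sum (fun m => P.map (N.dev m)) m {0}).trans ?_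
    rw [N.dev_poisson.sum_map_eq hmu.le]
    simp
  rw [Measure.map_apply (N.dev_poisson.1 m) (measurableSet_singleton _)] at h
  rw [ae_iff]
  simpa using! h

theorem ae_serviceDist_nonneg (z₀ : Fin nZ) : ∀ᵐ ω ∂P, ∀ m, 0 ≤ (N.mark m ω).1 := by
  have := isProbabilityMeasure_uniformOn_fin z₀
  have := isProbabilityMeasure_expMeasure one_pos
  have := N.isProbabilityMeasure_map_nearestDist
  rw [ae_all_iff]
  intro m
  have hfst : P.map (fun ω => (N.mark m ω).1) = P.map (nearestDist N.bs) := by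
    rw [← Function.comp_def Prod.fst, ← Measure.map_map measurable_fst (N.mark_meas m), N.mark_law m]
    exact Measure.fst_prod
  have h : ∀ᵐ R ∂(P.map fun ω => (N.mark m ω).1), 0 ≤ R := by
    rw [hfst, ae_map_iff (measurable_nearestDist N.bs_poisson.1).aemeasurable measurableSet_Ici]
    exact Eventually.of_forall fun ω => nearestDist_nonneg _ _
  rwa [ae_map_iff (N.mark_meas m).fst.aemeasurable measurableSet_Ici] at h

omit [IsProbabilityMeasure P] in
-- The condition `g < ρ` says `‖x‖ > R`, and `g = ρ ‖x / R‖^(-η)`; thus position and service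
-- distance enter only through `R⁻¹ • x`. For `R = 0` both sides vanish, the right one because `0⁻¹
-- = 0` and `outerGain η 0 = 0`.
theorem interTerm_eq_markedGain (hη : 0 < η) (hρ : 0 < ρ) {m : ℕ} {ω : Ω}
    (hx : N.dev m ω ≠ 0) (hR : 0 ≤ (N.mark m ω).1) :
    N.interTerm η ρ τ z₀ m ω = markedGain η ρ τ z₀ (N.dev m ω, N.mark m ω) := by
  have hx0 : 0 < ‖N.dev m ω‖ := norm_pos_iff.2 hx
  simp only [interTerm, markedGain]
  by_cases hq : τ < (N.mark m ω).2.1 ∧ (N.mark m ω).2.2 = z₀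
  · simp only [hq, true_and, and_self, if_true]
    rcases hR.eq_or_lt with h0 | hR0
    · simp [← h0, Real.zero_rpow hη.ne', outerGain_zero]
    · have hnorm : ‖(N.mark m ω).1⁻¹ • N.dev m ω‖ = ‖N.dev m ω‖ / (N.mark m ω).1 := by
        rw [norm_smul, norm_inv, Real.norm_eq_abs, abs_of_pos hR0]; ring
      have hg : ρ * (N.mark m ω).1 ^ η * ‖N.dev m ω‖ ^ (-η) =
          ρ * (‖N.dev m ω‖ / (N.mark m ω).1) ^ (-η) := by
        rw [Real.div_rpow hx0.le hR0.le, Real.rpow_neg hR0.le]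
        field_simp
      have hiff : ρ * (‖N.dev m ω‖ / (N.mark m ω).1) ^ (-η) < ρ ↔
          1 < ‖N.dev m ω‖ / (N.mark m ω).1 := by
        rw [mul_lt_iff_lt_one_right hρ, Real.rpow_lt_one_iff_of_pos (by positivity)]
        constructor
        · rintro (h | h)
          · exact h.1
          · linarith [h.2]
        · exact fun h => Or.inl ⟨h, by linarith⟩
      rw [hg, outerGain, hnorm]
      by_cases h1 : 1 < ‖N.dev m ω‖ / (N.mark m ω).1
      · rw [if_pos (hiff.2 h1), if_pos h1]
      · rw [if_neg (fun h => h1 (hiff.1 h)), if_neg h1]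
        simp
  · rw [if_neg hq, if_neg (fun h => hq ⟨h.1, h.2.1⟩)]

theorem ae_interTerm_eq (hη : 0 < η) (hρ : 0 < ρ) (hmu : 0 < mu) :
    ∀ᵐ ω ∂P, ∀ m, N.interTerm η ρ τ z₀ m ω = markedGain η ρ τ z₀ (N.dev m ω, N.mark m ω) := by
  filter_upwards [N.ae_dev_ne_zero hmu, N.ae_serviceDist_nonneg z₀] with ω h1 h2 m
  exact N.interTerm_eq_markedGain hη hρ (h1 m) (h2 m)

theorem ae_summable_interTerm (hη : 2 < η) (hρ : 0 < ρ) (hlam : 0 < lam) (hmu : 0 < mu) :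
    ∀ᵐ ω ∂P, Summable fun m => N.interTerm η ρ τ z₀ m ω := by
  have := isProbabilityMeasure_uniformOn_fin z₀
  have := isProbabilityMeasure_expMeasure one_pos
  have := N.isProbabilityMeasure_map_nearestDist
  filter_upwards [N.ae_interTerm_eq (τ := τ) (z₀ := z₀) (by linarith : 0 < η) hρ hmu,
    ae_summable_marked N.dev_poisson hmu.le N.mark_meas N.mark_law N.indep_dev
      (measurable_markedGain (η := η) (ρ := ρ) (τ := τ) (z₀ := z₀))
      (integrable_markedGain hη (N.integrable_sq_serviceDist hlam))] with ω h1 h2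
  simpa [h1] using h2

theorem interInterference_ae_eq (hη : 0 < η) (hρ : 0 < ρ) (hmu : 0 < mu) :
    N.interInterference η ρ τ z₀ =ᵐ[P]
      fun ω => ∑' m, markedGain η ρ τ z₀ (N.dev m ω, N.mark m ω) := by
  filter_upwards [N.ae_interTerm_eq (τ := τ) (z₀ := z₀) hη hρ hmu] with ω h
  simp [interInterference, h]

theorem integrable_interInterference (hη : 2 < η) (hρ : 0 < ρ) (hlam : 0 < lam) (hmu : 0 < mu) :
    Integrable (N.interInterference η ρ τ z₀) P := by
  have := isProbabilityMeasure_uniformOn_fin z₀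
  have := isProbabilityMeasure_expMeasure one_pos
  have := N.isProbabilityMeasure_map_nearestDist
  refine Integrable.congr ?_ (N.interInterference_ae_eq (by linarith) hρ hmu).symm
  exact integrable_tsum_marked N.dev_poisson hmu.le N.mark_meas N.mark_law N.indep_dev
    measurable_markedGain (integrable_markedGain hη (N.integrable_sq_serviceDist hlam))

theorem ae_interInterference_nonneg (hη : 2 < η) (hρ : 0 < ρ) (hτ : 0 ≤ τ) (hmu : 0 < mu) :
    ∀ᵐ ω ∂P, 0 ≤ N.interInterference η ρ τ z₀ ω := by
  filter_upwards [N.interInterference_ae_eq (τ := τ) (z₀ := z₀) (by linarith : 0 < η) hρ hmu]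
    with ω h
  rw [h]
  exact tsum_nonneg fun m => markedGain_nonneg hρ hτ _

/-- The Laplace transform of the inter-cell interference. -/
theorem integral_exp_neg_interInterference (hη : 2 < η) (hρ : 0 < ρ) (hτ : 0 ≤ τ)
    (hlam : 0 < lam) (hmu : 0 < mu) {s : ℂ} (hs : 0 ≤ s.re) :
    ∫ ω, Complex.exp (-s * N.interInterference η ρ τ z₀ ω) ∂P =
      interLaplace (Real.exp (-τ) * (mu / lam) / nZ) η ρ τ s := by
  have := isProbabilityMeasure_uniformOn_fin z₀
  have := isProbabilityMeasure_expMeasure one_pos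
  have := N.isProbabilityMeasure_map_nearestDist
  have hR := N.integrable_sq_serviceDist hlam
  have h := integral_exp_neg_tsum_marked N.dev_poisson hmu.le N.mark_meas N.mark_law N.mark_indep
    N.indep_dev (measurable_markedGain (η := η) (ρ := ρ) (τ := τ) (z₀ := z₀))
    (integrable_markedGain hη hR) (markedGain_nonneg hρ hτ) hs
  rw [interLaplace_eq _ τ (by linarith) hρ]
  refine Eq.trans (integral_congr_ae ?_) (h.trans ?_)
  · filter_upwards [N.interInterference_ae_eq (τ := τ) (z₀ := z₀) (by linarith : 0 < η) hρ hmu]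
      with ω h
    rw [h]
  -- The factor `mu * 2π * E R²` becomes `2 mu / lam`, so `π` cancels.
  · rw [integral_one_sub_exp_markedGain hη hρ hτ hR hs, N.integral_sq_serviceDist hlam]
    congr 2
    have h1 : (lam : ℂ) ≠ 0 := by exact_mod_cast hlam.ne'
    have h2 : (Real.pi : ℂ) ≠ 0 := by exact_mod_cast Real.pi_ne_zero
    push_cast
    field_simp

end Network

/-! ### Intra-cell and aggregate interference -/

/-- Regroups nested independence conditions by associativity of the product measure. -/
theorem indepFun_prodMk_of_indepFun_prodMk {Ω α β γ : Type*} [MeasurableSpace Ω]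
    [MeasurableSpace α] [MeasurableSpace β] [MeasurableSpace γ] {P : Measure Ω}
    [IsProbabilityMeasure P] {X : Ω → α} {Y : Ω → β} {Z : Ω → γ} (hX : Measurable X)
    (hY : Measurable Y) (hZ : Measurable Z) (h : IndepFun X (fun ω => (Y ω, Z ω)) P)
    (h' : IndepFun Y Z P) : IndepFun (fun ω => (X ω, Y ω)) Z P := by
  have hXY : IndepFun X Y P := h.comp (φ := id) (ψ := Prod.fst) measurable_id measurable_fst
  have := Measure.isProbabilityMeasure_map (μ := P) hX.aemeasurable
  have := Measure.isProbabilityMeasure_map (μ := P) hY.aemeasurable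
  have := Measure.isProbabilityMeasure_map (μ := P) hZ.aemeasurable
  rw [indepFun_iff_map_prod_eq_prod_map_map (hX.prodMk hY).aemeasurable hZ.aemeasurable,
    hXY.map_prod_eq_prod_map_map hX.aemeasurable hY.aemeasurable]
  have h1 := h.map_prod_eq_prod_map_map hX.aemeasurable (hY.prodMk hZ).aemeasurable
  rw [h'.map_prod_eq_prod_map_map hY.aemeasurable hZ.aemeasurable] at h1
  have h2 := ((measurePreserving_prodAssoc (P.map X) (P.map Y) (P.map Z)).symm _).map_eq
  rw [← h2, ← h1, Measure.map_map (MeasurableEquiv.measurable _) (hX.prodMk (hY.prodMk hZ))]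
  rfl

theorem measurable_poissonMeasure_singleton (mu : ℝ) (n : ℕ) :
    Measurable fun a : ℝ => poissonMeasure (mu * a).toNNReal {n} := by
  simp_rw [poissonMeasure_singleton]
  fun_prop

open Classical in
/-- Received power of a device of the test cell with gain `q.1` and code `q.2`. -/
noncomputable def cellGain (ρ τ : ℝ) {nZ : ℕ} (z₀ : Fin nZ) (q : ℝ × Fin nZ) : ℝ :=
  if τ < q.1 ∧ q.2 = z₀ then ρ * q.1 else 0

section CellGain

variable {ρ τ : ℝ} {nZ : ℕ} {z₀ : Fin nZ}

theorem cellGain_nonneg (hρ : 0 < ρ) (hτ : 0 ≤ τ) (q : ℝ × Fin nZ) : 0 ≤ cellGain ρ τ z₀ q := by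
  unfold cellGain
  split_ifs with h
  · exact mul_nonneg hρ.le (hτ.trans h.1.le)
  · exact le_rfl

theorem measurable_cellGain : Measurable (cellGain ρ τ z₀) := by
  refine Measurable.ite ?_ (by fun_prop) measurable_const
  exact (measurableSet_lt measurable_const measurable_fst).inter
    (measurable_snd (measurableSet_singleton z₀))

theorem integrable_cellGain : Integrable (cellGain ρ τ z₀) (gainCodeLaw nZ) := by
  refine ((integrable_fst_gainCodeLaw z₀).const_mul ρ).norm.mono'
    measurable_cellGain.aestronglyMeasurable (Eventually.of_forall fun q => ?_)
  unfold cellGain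
  split_ifs
  · exact le_rfl
  · rw [norm_zero]; exact norm_nonneg _

theorem integral_exp_neg_cellGain (hρ : 0 < ρ) (hτ : 0 ≤ τ) {s : ℂ} (hs : 0 ≤ s.re) :
    ∫ q, Complex.exp (-s * cellGain ρ τ z₀ q) ∂(gainCodeLaw nZ) =
      1 - Real.exp (-τ) / nZ * gainDefect τ (s * ρ) := by
  have := isProbabilityMeasure_uniformOn_fin z₀
  have := isProbabilityMeasure_expMeasure one_pos
  have hw : 0 ≤ (s * ρ).re := by
    rw [Complex.re_mul_ofReal]; exact mul_nonneg hs hρ.le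
  have hm := measurable_cellGain (ρ := ρ) (τ := τ) (z₀ := z₀)
  have hi : Integrable (fun q => Complex.exp (-s * cellGain ρ τ z₀ q)) (gainCodeLaw nZ) :=
    Integrable.of_bound (by fun_prop) 1
      (Eventually.of_forall fun q => norm_exp_neg_mul_le_one hs (cellGain_nonneg hρ hτ q))
  rw [gainDefect, ← integral_ite_gainCodeLaw z₀ hτ hw, eq_sub_iff_add_eq, ← eq_sub_iff_add_eq']
  have h1 : (1 : ℂ) = ∫ _, (1 : ℂ) ∂(gainCodeLaw nZ) := by simp
  refine Eq.trans ?_ (congrArg (· - _) h1.symm)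
  rw [← integral_sub (integrable_const _) hi]
  refine integral_congr_ae (Eventually.of_forall fun q => ?_)
  simp only [cellGain]
  by_cases h : τ < q.1 ∧ q.2 = z₀
  · simp only [h, and_self, if_true]
    push_cast
    ring_nf
  · simp [h]

end CellGain

namespace Network

variable {Ω : Type*} [MeasurableSpace Ω] {P : Measure Ω} [IsProbabilityMeasure P]
  {lam mu : ℝ} {nZ : ℕ} {η ρ τ : ℝ} {z₀ : Fin nZ} (N : Network P lam mu nZ)

omit [IsProbabilityMeasure P] in
theorem measurable_cellMarks : Measurable fun ω i => N.cellMark i ω :=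
  measurable_pi_lambda _ N.cellMark_meas

omit [IsProbabilityMeasure P] in
theorem measurable_devs : Measurable fun ω m => N.dev m ω :=
  measurable_pi_lambda _ N.dev_poisson.1

omit [IsProbabilityMeasure P] in
theorem measurable_marks : Measurable fun ω m => N.mark m ω :=
  measurable_pi_lambda _ N.mark_meas

omit [IsProbabilityMeasure P] in
theorem indepFun_cellNum_cellMark : IndepFun N.cellNum (fun ω i => N.cellMark i ω) P :=
  N.indep_cellNum.comp (φ := id) (ψ := Prod.fst) measurable_id measurable_fst

/-- The sum of the received powers as a function of the number of devices and their marks. -/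
noncomputable def intraSum (ρ τ : ℝ) {nZ : ℕ} (z₀ : Fin nZ) (p : ℕ × (ℕ → ℝ × Fin nZ)) : ℝ :=
  ∑ i ∈ Finset.range p.1, cellGain ρ τ z₀ (p.2 i)

theorem measurable_intraSum : Measurable (intraSum ρ τ z₀) := by
  refine measurable_from_prod_countable_right fun n => ?_
  have h : ∀ i, Measurable fun c : ℕ → ℝ × Fin nZ => cellGain ρ τ z₀ (c i) :=
    fun i => measurable_cellGain.comp (measurable_pi_apply i)
  exact Finset.measurable_fun_sum (Finset.range n) fun i _ => h i

omit [IsProbabilityMeasure P] in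
theorem measurable_intraInterference : Measurable (N.intraInterference ρ τ z₀) :=
  measurable_intraSum.comp (N.cellNum_meas.prodMk N.measurable_cellMarks)

omit [IsProbabilityMeasure P] in
theorem intraInterference_nonneg (hρ : 0 < ρ) (hτ : 0 ≤ τ) (ω : Ω) :
    0 ≤ N.intraInterference ρ τ z₀ ω :=
  Finset.sum_nonneg fun _ _ => cellGain_nonneg hρ hτ _

omit [IsProbabilityMeasure P] in
theorem map_cellNum_singleton (n : ℕ) : P.map N.cellNum {n} =
    ∫⁻ a, poissonMeasure (mu * a).toNNReal {n}
      ∂(gammaMeasure voronoiConst (voronoiConst * lam)) := by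
  rw [Measure.map_apply N.cellNum_meas (measurableSet_singleton _), ← N.cellNum_law n]
  rfl

theorem voronoiConst_pos : 0 < voronoiConst := by norm_num [voronoiConst]

/-- Wald's identity bounds the mean by the mean number of devices times the mean power of one; the
former is `mu` times the mean cell area. Gil-Pelaez inversion requires this moment. -/
theorem integrable_intraInterference (hlam : 0 < lam) :
    Integrable (N.intraInterference ρ τ z₀) P := by
  have hc := voronoiConst_pos
  have hcl : 0 < voronoiConst * lam := by positivity
  refine ⟨N.measurable_intraInterference.aestronglyMeasurable, ?_⟩
  have hw : ∀ i, Measurable fun c : ℕ → ℝ × Fin nZ => ‖cellGain ρ τ z₀ (c i)‖ₑ :=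
    fun i => (measurable_cellGain.comp (measurable_pi_apply i)).enorm
  have hm : Measurable fun p : ℕ × (ℕ → ℝ × Fin nZ) =>
      ∑ i ∈ Finset.range p.1, ‖cellGain ρ τ z₀ (p.2 i)‖ₑ := by
    refine measurable_from_prod_countable_right fun n => ?_
    exact Finset.measurable_fun_sum (Finset.range n) fun i _ => hw i
  have := Measure.isProbabilityMeasure_map (μ := P) N.cellNum_meas.aemeasurable
  have := Measure.isProbabilityMeasure_map (μ := P) N.measurable_cellMarks.aemeasurable
  calc ∫⁻ ω, ‖N.intraInterference ρ τ z₀ ω‖ₑ ∂P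
      ≤ ∫⁻ ω, ∑ i ∈ Finset.range (N.cellNum ω), ‖cellGain ρ τ z₀ (N.cellMark i ω)‖ₑ ∂P :=
        lintegral_mono fun ω => enorm_sum_le _ _
    _ = ∫⁻ n, ∫⁻ c, ∑ i ∈ Finset.range n, ‖cellGain ρ τ z₀ (c i)‖ₑ
          ∂(P.map fun ω i => N.cellMark i ω) ∂(P.map N.cellNum) := by
        rw [← lintegral_map hm (N.cellNum_meas.prodMk N.measurable_cellMarks),
          N.indepFun_cellNum_cellMark.map_prod_eq_prod_map_map N.cellNum_meas.aemeasurable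
            N.measurable_cellMarks.aemeasurable, lintegral_prod _ hm.aemeasurable]
    _ = ∫⁻ n, (n : ℝ≥0∞) * ∫⁻ q, ‖cellGain ρ τ z₀ q‖ₑ ∂(gainCodeLaw nZ) ∂(P.map N.cellNum) := by
        refine lintegral_congr fun n => ?_
        rw [lintegral_finsetSum _ fun i _ => hw i]
        have h1 : ∀ i, ∫⁻ c, ‖cellGain ρ τ z₀ (c i)‖ₑ ∂(P.map fun ω i => N.cellMark i ω) =
            ∫⁻ q, ‖cellGain ρ τ z₀ q‖ₑ ∂(gainCodeLaw nZ) := by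
          intro i
          rw [lintegral_map (hw i)
            N.measurable_cellMarks, gainCodeLaw, ← N.cellMark_law i,
            lintegral_map measurable_cellGain.enorm (N.cellMark_meas i)]
        simp_rw [h1]
        simp
    _ = (∫⁻ a, ((mu * a).toNNReal : ℝ≥0∞) ∂(gammaMeasure voronoiConst (voronoiConst * lam))) *
          ∫⁻ q, ‖cellGain ρ τ z₀ q‖ₑ ∂(gainCodeLaw nZ) := by
        rw [lintegral_mul_const _ .of_discrete, lintegral_countable']
        congr 1
        simp_rw [N.map_cellNum_singleton, ← lintegral_natCast_poissonMeasure, lintegral_countable']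
        rw [lintegral_tsum fun n =>
          ((measurable_poissonMeasure_singleton mu n).const_mul _).aemeasurable]
        congr with n
        rw [lintegral_const_mul _ (measurable_poissonMeasure_singleton mu n)]
    _ < ∞ := by
        refine ENNReal.mul_lt_top ?_ integrable_cellGain.2
        have h := ((integrable_id_gammaMeasure hc hcl).const_mul mu).2
        refine lt_of_le_of_lt (lintegral_mono fun a => ?_) h
        exact Real.ofReal_le_enorm _

/-- Given area `a` the count has generating function `exp (-mu a (1 - q))`; averaging over `a`
evaluates the Gamma Laplace transform at `mu (1 - q)`, whose real part is nonnegative because `‖q‖ ≤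
1`. -/
theorem integral_pow_cellNum (hlam : 0 < lam) (hmu : 0 < mu) {q : ℂ} (hq : ‖q‖ ≤ 1) :
    ∫ n, q ^ n ∂(P.map N.cellNum) =
      1 / (1 + mu * (1 - q) / (voronoiConst * lam : ℝ)) ^ (voronoiConst : ℂ) := by
  have hc := voronoiConst_pos
  have hcl : 0 < voronoiConst * lam := by positivity
  have := isProbabilityMeasure_gammaMeasure hc hcl
  have := Measure.isProbabilityMeasure_map (μ := P) N.cellNum_meas.aemeasurable
  set Γ := gammaMeasure voronoiConst (voronoiConst * lam) with hΓ
  have hw : 0 ≤ (mu * (1 - q)).re := by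
    rw [Complex.re_ofReal_mul]
    refine mul_nonneg hmu.le ?_
    have := (Complex.re_le_norm q).trans hq
    simpa using this
  have hqn : ∀ n : ℕ, ‖q ^ n‖ ≤ 1 := fun n => by
    rw [norm_pow]; exact pow_le_one₀ (norm_nonneg _) hq
  rw [← integral_exp_neg_mul_gammaMeasure hc hcl hw, ← hΓ]
  have hreal : ∀ n, (P.map N.cellNum).real {n} =
      ∫ a, (poissonMeasure (mu * a).toNNReal).real {n} ∂Γ := by
    intro n
    rw [Measure.real, N.map_cellNum_singleton]
    exact (integral_toReal (measurable_poissonMeasure_singleton mu n).aemeasurable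
      (Eventually.of_forall fun a => measure_lt_top _ _)).symm
  have hpm : ∀ n, Measurable fun a : ℝ => (poissonMeasure (mu * a).toNNReal).real {n} :=
    fun n => (measurable_poissonMeasure_singleton mu n).ennreal_toReal
  have hpi : ∀ n, Integrable (fun a : ℝ => (poissonMeasure (mu * a).toNNReal).real {n}) Γ :=
    fun n => Integrable.of_bound (hpm n).aestronglyMeasurable 1 (Eventually.of_forall fun a => by
      rw [Real.norm_eq_abs, abs_of_nonneg measureReal_nonneg]; exact measureReal_le_one)
  have hFi : ∀ n, Integrable
      (fun a : ℝ => (poissonMeasure (mu * a).toNNReal).real {n} • q ^ n) Γ :=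
    fun n => (hpi n).smul_const _
  have hsum : Summable fun n => (P.map N.cellNum).real {n} := by
    refine ENNReal.summable_toReal ?_
    have := lintegral_countable' (μ := P.map N.cellNum) fun _ => (1 : ℝ≥0∞)
    simp only [lintegral_const, measure_univ, mul_one, one_mul] at this
    rw [← this]
    exact ENNReal.one_ne_top
  have hint : Integrable (fun n : ℕ => q ^ n) (P.map N.cellNum) :=
    Integrable.of_bound (by exact Measurable.of_discrete.aestronglyMeasurable) 1
      (Eventually.of_forall hqn)
  calc ∫ n, q ^ n ∂(P.map N.cellNum)
      = ∑' n, (P.map N.cellNum).real {n} • q ^ n := integral_countable hint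
    _ = ∑' n, ∫ a, (poissonMeasure (mu * a).toNNReal).real {n} • q ^ n ∂Γ := by
        congr with n
        rw [hreal, integral_smul_const]
    _ = ∫ a, ∑' n, (poissonMeasure (mu * a).toNNReal).real {n} • q ^ n ∂Γ := by
        refine integral_tsum_of_summable_integral_norm hFi ?_
        refine Summable.of_nonneg_of_le (fun n => integral_nonneg fun _ => norm_nonneg _)
          (fun n => ?_) hsum
        rw [hreal]
        refine integral_mono (hFi n).norm (hpi n) fun a => ?_
        simp only [norm_smul, Real.norm_eq_abs, abs_of_nonneg measureReal_nonneg]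
        exact mul_le_of_le_one_right measureReal_nonneg (hqn n)
    _ = ∫ a, Complex.exp (-(mu * (1 - q)) * a) ∂Γ := by
        refine integral_congr_ae ?_
        filter_upwards [ae_nonneg_gammaMeasure voronoiConst (voronoiConst * lam)] with a ha
        have hP : Integrable (fun n : ℕ => q ^ n) (poissonMeasure (mu * a).toNNReal) :=
          Integrable.of_bound (by exact Measurable.of_discrete.aestronglyMeasurable) 1
            (Eventually.of_forall hqn)
        rw [← integral_countable hP, integral_pow_poissonMeasure,
          Real.coe_toNNReal _ (by positivity)]
        push_cast
        ring_nf

/-- The Laplace transform of the intra-cell interference. -/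
theorem integral_exp_neg_intraInterference (hρ : 0 < ρ) (hτ : 0 ≤ τ) (hlam : 0 < lam)
    (hmu : 0 < mu) {s : ℂ} (hs : 0 ≤ s.re) :
    ∫ ω, Complex.exp (-s * N.intraInterference ρ τ z₀ ω) ∂P =
      intraLaplace (Real.exp (-τ) * (mu / lam) / nZ) ρ τ s := by
  have := isProbabilityMeasure_uniformOn_fin z₀
  have := isProbabilityMeasure_expMeasure one_pos
  have := Measure.isProbabilityMeasure_map (μ := P) N.cellNum_meas.aemeasurable
  have := Measure.isProbabilityMeasure_map (μ := P) N.measurable_cellMarks.aemeasurable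
  set q : ℂ := ∫ q, Complex.exp (-s * cellGain ρ τ z₀ q) ∂(gainCodeLaw nZ) with hq
  have hg : Measurable fun q : ℝ × Fin nZ => Complex.exp (-s * cellGain ρ τ z₀ q) := by
    have := measurable_cellGain (ρ := ρ) (τ := τ) (z₀ := z₀)
    fun_prop
  have hg1 : ∀ q : ℝ × Fin nZ, ‖Complex.exp (-s * cellGain ρ τ z₀ q)‖ ≤ 1 :=
    fun q => norm_exp_neg_mul_le_one hs (cellGain_nonneg hρ hτ q)
  have hq1 : ‖q‖ ≤ 1 := by
    refine (norm_integral_le_of_norm_le_const (Eventually.of_forall hg1)).trans_eq ?_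
    simp
  have hF : Measurable fun p : ℕ × (ℕ → ℝ × Fin nZ) =>
      Complex.exp (-s * intraSum ρ τ z₀ p) := by
    have := measurable_intraSum (ρ := ρ) (τ := τ) (z₀ := z₀)
    fun_prop
  have hF1 : ∀ p : ℕ × (ℕ → ℝ × Fin nZ), ‖Complex.exp (-s * intraSum ρ τ z₀ p)‖ ≤ 1 :=
    fun p => norm_exp_neg_mul_le_one hs (Finset.sum_nonneg fun _ _ => cellGain_nonneg hρ hτ _)
  have hpow : ∀ n : ℕ, ∫ c, Complex.exp (-s * intraSum ρ τ z₀ (n, c))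
      ∂(P.map fun ω i => N.cellMark i ω) = q ^ n := by
    intro n
    have hFn : Measurable fun c => Complex.exp (-s * intraSum ρ τ z₀ (n, c)) :=
      hF.comp measurable_prodMk_left
    rw [integral_map N.measurable_cellMarks.aemeasurable hFn.aestronglyMeasurable]
    have hexp : ∀ ω, Complex.exp (-s * intraSum ρ τ z₀ (n, fun i => N.cellMark i ω)) =
        ∏ i : Fin n, Complex.exp (-s * cellGain ρ τ z₀ (N.cellMark i ω)) := by
      intro ω
      rw [intraSum, ← Complex.exp_sum, ← Finset.mul_sum, Finset.sum_range]
      push_cast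
      rfl
    simp_rw [hexp]
    have hMn : iIndepFun (fun i : Fin n => N.cellMark i) P :=
      N.cellMark_indep.precomp Fin.val_injective
    rw [hMn.integral_fun_prod_comp
      (f := fun (_ : Fin n) q => Complex.exp (-s * cellGain ρ τ z₀ q))
      (fun i => (N.cellMark_meas i).aemeasurable) fun i => hg.aestronglyMeasurable]
    have h1 : ∀ i : Fin n, ∫ ω, Complex.exp (-s * cellGain ρ τ z₀ (N.cellMark i ω)) ∂P = q := by
      intro i
      rw [hq, gainCodeLaw, ← N.cellMark_law i,
        integral_map (N.cellMark_meas i).aemeasurable hg.aestronglyMeasurable]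
    rw [Finset.prod_congr rfl fun i _ => h1 i]
    simp
  calc ∫ ω, Complex.exp (-s * N.intraInterference ρ τ z₀ ω) ∂P
      = ∫ n, ∫ c, Complex.exp (-s * intraSum ρ τ z₀ (n, c))
          ∂(P.map fun ω i => N.cellMark i ω) ∂(P.map N.cellNum) := by
        rw [← integral_prod (fun p => Complex.exp (-s * intraSum ρ τ z₀ p))
          (Integrable.of_bound hF.aestronglyMeasurable 1 (Eventually.of_forall hF1)),
          ← N.indepFun_cellNum_cellMark.map_prod_eq_prod_map_map N.cellNum_meas.aemeasurable
            N.measurable_cellMarks.aemeasurable,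
          integral_map (N.cellNum_meas.prodMk N.measurable_cellMarks).aemeasurable
            hF.aestronglyMeasurable]
        rfl
    _ = _ := by
        simp_rw [hpow]
        rw [N.integral_pow_cellNum hlam hmu hq1, hq, integral_exp_neg_cellGain hρ hτ hs,
          intraLaplace]
        congr 3
        have hlc : (lam : ℂ) ≠ 0 := by exact_mod_cast hlam.ne'
        have hcc : (voronoiConst : ℂ) ≠ 0 := by exact_mod_cast voronoiConst_pos.ne'
        have hsρ : 0 ≤ (s * ρ).re := by
          rw [Complex.re_mul_ofReal]; exact mul_nonneg hs hρ.le
        have hne : 1 + s * ρ ≠ 0 := by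
          rw [add_comm]
          intro h
          have := one_le_norm_add_one hsρ
          rw [h, norm_zero] at this
          linarith
        have hnZ : (nZ : ℂ) ≠ 0 := by
          exact_mod_cast (Nat.pos_of_ne_zero fun h => by subst h; exact z₀.elim0).ne'
        rw [gainDefect, add_comm (s * ρ) 1, ← mul_assoc]
        push_cast
        field_simp
        ring

omit [IsProbabilityMeasure P] in
/-- The inter-cell interference as a function of the devices and their marks. -/
theorem exists_interInterference_eq (η ρ τ : ℝ) (z₀ : Fin nZ) :
    ∃ Ψ : (ℕ → Plane) × (ℕ → ℝ × ℝ × Fin nZ) → ℝ, Measurable Ψ ∧ ∀ (N : Network P lam mu nZ) ω,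
      N.interInterference η ρ τ z₀ ω = Ψ ((fun m => N.dev m ω), fun m => N.mark m ω) := by
  classical
  refine ⟨fun p => ∑' m,
    if τ < (p.2 m).2.1 ∧ (p.2 m).2.2 = z₀ ∧ ρ * (p.2 m).1 ^ η * ‖p.1 m‖ ^ (-η) < ρ then
      ρ * (p.2 m).1 ^ η * ‖p.1 m‖ ^ (-η) * (p.2 m).2.1 else 0, ?_, fun N ω => ?_⟩
  · refine Measurable.tsum fun m => ?_
    have hx : Measurable fun p : (ℕ → Plane) × (ℕ → ℝ × ℝ × Fin nZ) => p.1 m :=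
      (measurable_pi_apply m).comp measurable_fst
    have hk : Measurable fun p : (ℕ → Plane) × (ℕ → ℝ × ℝ × Fin nZ) => p.2 m :=
      (measurable_pi_apply m).comp measurable_snd
    have hR := hk.fst
    have hh := hk.snd.fst
    have hz := hk.snd.snd
    have hg : Measurable fun p : (ℕ → Plane) × (ℕ → ℝ × ℝ × Fin nZ) =>
        ρ * (p.2 m).1 ^ η * ‖p.1 m‖ ^ (-η) := by fun_prop
    refine Measurable.ite ?_ (hg.mul hh) measurable_const
    exact (measurableSet_lt measurable_const hh).inter
      ((hz (measurableSet_singleton z₀)).inter (measurableSet_lt hg measurable_const))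
  · unfold interInterference interTerm
    refine tsum_congr fun m => ?_
    congr

omit [IsProbabilityMeasure P] in
theorem measurable_interInterference : Measurable (N.interInterference η ρ τ z₀) := by
  obtain ⟨Ψ, hΨ, h⟩ := exists_interInterference_eq (P := P) (lam := lam) (mu := mu) η ρ τ z₀
  rw [funext (h N)]
  exact hΨ.comp (N.measurable_devs.prodMk N.measurable_marks)

omit [IsProbabilityMeasure P] in
theorem measurable_interference : Measurable (N.interference η ρ τ z₀) :=
  N.measurable_intraInterference.add N.measurable_interInterference

theorem indepFun_intra_inter :
    IndepFun (N.intraInterference ρ τ z₀) (N.interInterference η ρ τ z₀) P := by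
  obtain ⟨Ψ, hΨ, h⟩ := exists_interInterference_eq (P := P) (lam := lam) (mu := mu) η ρ τ z₀
  rw [funext (h N)]
  have hI := indepFun_prodMk_of_indepFun_prodMk N.cellNum_meas N.measurable_cellMarks
    (N.measurable_devs.prodMk N.measurable_marks) N.indep_cellNum N.indep_cellMark
  exact hI.comp (φ := intraSum ρ τ z₀) (ψ := Ψ) measurable_intraSum hΨ

omit [IsProbabilityMeasure P] in
theorem indepFun_gain_interference : IndepFun N.gain (N.interference η ρ τ z₀) P := by
  obtain ⟨Ψ, hΨ, h⟩ := exists_interInterference_eq (P := P) (lam := lam) (mu := mu) η ρ τ z₀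
  let G : ℕ × (ℕ → ℝ × Fin nZ) × (ℕ → Plane) × (ℕ → ℝ × ℝ × Fin nZ) → ℝ :=
    fun p => intraSum ρ τ z₀ (p.1, p.2.1) + Ψ p.2.2
  have hG : Measurable G :=
    (measurable_intraSum.comp (measurable_fst.prodMk measurable_snd.fst)).add
      (hΨ.comp measurable_snd.snd)
  have hfun : N.interference η ρ τ z₀ = G ∘ fun ω => (N.cellNum ω, (fun i => N.cellMark i ω),
      (fun m => N.dev m ω), fun m => N.mark m ω) := by
    ext ω
    simp only [interference, h N ω, Function.comp_apply, G]
    rfl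
  rw [hfun]
  exact N.indep_gain.comp (φ := id) measurable_id hG

/-- The Laplace transform of the aggregate interference. -/
theorem integral_exp_neg_interference (hη : 2 < η) (hρ : 0 < ρ) (hτ : 0 ≤ τ) (hlam : 0 < lam)
    (hmu : 0 < mu) {s : ℂ} (hs : 0 ≤ s.re) :
    ∫ ω, Complex.exp (-s * N.interference η ρ τ z₀ ω) ∂P =
      interLaplace (Real.exp (-τ) * (mu / lam) / nZ) η ρ τ s *
        intraLaplace (Real.exp (-τ) * (mu / lam) / nZ) ρ τ s := by
  rw [← N.integral_exp_neg_intraInterference (z₀ := z₀) hρ hτ hlam hmu hs,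
    ← N.integral_exp_neg_interInterference (z₀ := z₀) hη hρ hτ hlam hmu hs, mul_comm]
  have he : Measurable fun x : ℝ => Complex.exp (-s * x) := by fun_prop
  rw [← N.indepFun_intra_inter.integral_fun_comp_mul_comp (f := fun x : ℝ => Complex.exp (-s * x))
    (g := fun x : ℝ => Complex.exp (-s * x)) N.measurable_intraInterference.aemeasurable
    N.measurable_interInterference.aemeasurable he.aestronglyMeasurable he.aestronglyMeasurable]
  congr with ω
  rw [← Complex.exp_add, interference]
  push_cast
  ring_nf

theorem integrable_interference (hη : 2 < η) (hρ : 0 < ρ) (hlam : 0 < lam) (hmu : 0 < mu) :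
    Integrable (N.interference η ρ τ z₀) P :=
  (N.integrable_intraInterference hlam).add (N.integrable_interInterference hη hρ hlam hmu)

theorem ae_interference_nonneg (hη : 2 < η) (hρ : 0 < ρ) (hτ : 0 ≤ τ) (hmu : 0 < mu) :
    ∀ᵐ ω ∂P, 0 ≤ N.interference η ρ τ z₀ ω := by
  filter_upwards [N.ae_interInterference_nonneg (z₀ := z₀) hη hρ hτ hmu] with ω h
  exact add_nonneg (N.intraInterference_nonneg hρ hτ ω) h

end Network

/-! ### Success probability -/

section ClosedForm

variable {η ρ θ τ : ℝ}

/-- The transform depends on `s` and `ρ` only through `s * ρ = θ`. Undoing the radial scaling with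
`θ` in place of `ρ` moves the lower limit to `θ ^ (-1 / η)`. -/
theorem interLaplace_ofReal_div (K τ : ℝ) (hη : 0 < η) (hρ : 0 < ρ) (hθ : 0 < θ) :
    interLaplace K η ρ τ (θ / ρ : ℝ) = (Real.exp (-(2 * K * θ ^ (2 / η) *
      ∫ y in Ioi (θ ^ (-1 / η)), (1 - Real.exp (-τ * y ^ (-η)) / (y ^ (-η) + 1)) * y)) : ℝ) := by
  have hρc : (ρ : ℂ) ≠ 0 := by exact_mod_cast hρ.ne'
  have h1 : ((θ / ρ : ℝ) : ℂ) * ρ = 1 * θ := by push_cast; field_simp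
  rw [interLaplace_eq K τ hη hρ, h1, ← rpow_mul_integral_gainDefect τ hη hθ 1]
  have h2 : ∀ y : ℝ, gainDefect τ (1 * (y ^ (-η) : ℝ)) * y =
      (((1 - Real.exp (-τ * y ^ (-η)) / (y ^ (-η) + 1)) * y : ℝ) : ℂ) := by
    intro y
    rw [gainDefect, one_mul]
    push_cast
    rfl
  simp_rw [h2]
  rw [integral_complex_ofReal]
  push_cast
  ring_nf

theorem intraLaplace_ofReal_div {K : ℝ} (hK : 0 ≤ K) (hτ : 0 ≤ τ) (hρ : 0 < ρ) (hθ : 0 < θ) :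
    intraLaplace K ρ τ (θ / ρ : ℝ) = ((1 / (1 + K * ((1 + θ) - Real.exp (-τ * θ)) /
      ((1 + θ) * voronoiConst)) ^ voronoiConst : ℝ) : ℂ) := by
  have hρc : (ρ : ℂ) ≠ 0 := by exact_mod_cast hρ.ne'
  have h1 : ((θ / ρ : ℝ) : ℂ) * ρ = θ := by push_cast; field_simp
  have hc := Network.voronoiConst_pos
  have hexp : Real.exp (-τ * θ) ≤ 1 := Real.exp_le_one_iff.2 (by nlinarith)
  have hbase : 0 ≤ 1 + K * ((1 + θ) - Real.exp (-τ * θ)) / ((1 + θ) * voronoiConst) := by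
    have : 0 ≤ (1 + θ) - Real.exp (-τ * θ) := by linarith
    positivity
  rw [intraLaplace, mul_assoc _ _ (ρ : ℂ), h1]
  push_cast
  rw [Complex.ofReal_cpow hbase]
  push_cast
  rfl

end ClosedForm

namespace Network

variable {Ω : Type*} [MeasurableSpace Ω] {P : Measure Ω} [IsProbabilityMeasure P]
  {lam mu : ℝ} {nZ : ℕ} {η ρ τ σ θ : ℝ} {z₀ : Fin nZ} (N : Network P lam mu nZ)

/-- The point `s = -it` lies on the boundary `Re s = 0`, which is why the transforms are computed on
the closed half-plane. -/
theorem charFun_map_interference (hη : 2 < η) (hρ : 0 < ρ) (hτ : 0 ≤ τ) (hlam : 0 < lam)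
    (hmu : 0 < mu) (t : ℝ) :
    charFun (P.map (N.interference η ρ τ z₀)) t =
      interLaplace (Real.exp (-τ) * (mu / lam) / nZ) η ρ τ (-Complex.I * t) *
        intraLaplace (Real.exp (-τ) * (mu / lam) / nZ) ρ τ (-Complex.I * t) := by
  rw [← N.integral_exp_neg_interference (z₀ := z₀) hη hρ hτ hlam hmu (by simp),
    charFun_apply_real, integral_map N.measurable_interference.aemeasurable (by fun_prop)]
  congr with ω
  ring_nf

theorem integrableOn_charFun_map_interference (hη : 2 < η) (hρ : 0 < ρ) (hτ : 0 ≤ τ)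
    (hlam : 0 < lam) (hmu : 0 < mu) :
    IntegrableOn (charFun (P.map (N.interference η ρ τ z₀))) (Ioi 0) := by
  have := Measure.isProbabilityMeasure_map (μ := P)
    (N.measurable_interference (η := η) (ρ := ρ) (τ := τ) (z₀ := z₀)).aemeasurable
  have hnZ : (0 : ℝ) < nZ := by
    exact_mod_cast Nat.pos_of_ne_zero fun h => by subst h; exact z₀.elim0
  have hK : 0 < Real.exp (-τ) * (mu / lam) / nZ := by positivity
  refine (integrableOn_exp_bound hK hη hρ).mono' measurable_charFun.aestronglyMeasurable ?_
  filter_upwards [ae_restrict_mem measurableSet_Ioi] with t ht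
  rw [N.charFun_map_interference hη hρ hτ hlam hmu, norm_mul]
  -- Read off from the probabilistic meaning of the factor, not from its closed form.
  have h1 : ‖intraLaplace (Real.exp (-τ) * (mu / lam) / nZ) ρ τ (-Complex.I * t)‖ ≤ 1 := by
    rw [← N.integral_exp_neg_intraInterference (z₀ := z₀) hρ hτ hlam hmu (by simp)]
    refine (norm_integral_le_of_norm_le_const (Eventually.of_forall fun ω =>
      norm_exp_neg_mul_le_one (by simp) (N.intraInterference_nonneg hρ hτ ω))).trans_eq ?_
    simp
  exact (mul_le_of_le_one_right (norm_nonneg _) h1).trans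
    (norm_interLaplace_le hK.le hτ hη hρ ht)

theorem integrable_id_map_interference (hη : 2 < η) (hρ : 0 < ρ) (hlam : 0 < lam) (hmu : 0 < mu) :
    Integrable id (P.map (N.interference η ρ τ z₀)) := by
  rw [integrable_map_measure measurable_id.aestronglyMeasurable
    N.measurable_interference.aemeasurable]
  exact N.integrable_interference hη hρ hlam hmu

/-- With `σ = 0` the SINR denominator vanishes where `𝓘 = 0`. That event is null because the law of
`𝓘` has no atoms. -/
theorem ae_interference_pos (hη : 2 < η) (hρ : 0 < ρ) (hτ : 0 ≤ τ) (hlam : 0 < lam)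
    (hmu : 0 < mu) : ∀ᵐ ω ∂P, 0 < N.interference η ρ τ z₀ ω := by
  have hm := N.measurable_interference (η := η) (ρ := ρ) (τ := τ) (z₀ := z₀)
  have := Measure.isProbabilityMeasure_map (μ := P) hm.aemeasurable
  have h := measure_singleton_eq_zero_of_integrableOn_charFun _
    (N.integrableOn_charFun_map_interference (z₀ := z₀) hη hρ hτ hlam hmu) 0
  rw [Measure.map_apply hm (measurableSet_singleton _)] at h
  have h' : ∀ᵐ ω ∂P, N.interference η ρ τ z₀ ω ≠ 0 := by
    rw [ae_iff]; simpa using! h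
  filter_upwards [h', N.ae_interference_nonneg (z₀ := z₀) hη hρ hτ hmu] with ω h1 h2
  exact lt_of_le_of_ne h2 h1.symm

omit [IsProbabilityMeasure P] in
theorem interferenceCDF_eq (x : ℝ) : N.interferenceCDF η ρ τ z₀ x =
    (P.map (N.interference η ρ τ z₀)).real (Iic x) := by
  rw [Measure.real, Measure.map_apply N.measurable_interference measurableSet_Iic]
  rfl

/-- Conditioning on the interference leaves the tail `e^{-z}` of the independent exponential gain,
valid since the threshold is nonnegative. -/
theorem measureReal_lt_gain {z : ℝ → ℝ} (hz : Measurable z) (hz0 : ∀ y, 0 ≤ z y) :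
    P.real {ω | z (N.interference η ρ τ z₀ ω) < N.gain ω} =
      ∫ ω, Real.exp (-z (N.interference η ρ τ z₀ ω)) ∂P := by
  have := isProbabilityMeasure_expMeasure one_pos
  have hm := N.measurable_interference (η := η) (ρ := ρ) (τ := τ) (z₀ := z₀)
  have := Measure.isProbabilityMeasure_map (μ := P) hm.aemeasurable
  have hS : MeasurableSet {p : ℝ × ℝ | z p.2 < p.1} :=
    measurableSet_lt (hz.comp measurable_snd) measurable_fst
  have h1 : P {ω | z (N.interference η ρ τ z₀ ω) < N.gain ω} =
      ∫⁻ ω, ENNReal.ofReal (Real.exp (-z (N.interference η ρ τ z₀ ω))) ∂P := by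
    have hset : {ω | z (N.interference η ρ τ z₀ ω) < N.gain ω} =
        (fun ω => (N.gain ω, N.interference η ρ τ z₀ ω)) ⁻¹' {p : ℝ × ℝ | z p.2 < p.1} := rfl
    have hexp : Measurable fun y => ENNReal.ofReal (Real.exp (-z y)) := by fun_prop
    rw [hset, ← Measure.map_apply (N.gain_meas.prodMk hm) hS,
      N.indepFun_gain_interference.map_prod_eq_prod_map_map N.gain_meas.aemeasurable
        hm.aemeasurable, N.gain_law, Measure.prod_apply_symm hS,
      ← lintegral_map hexp hm]
    refine lintegral_congr fun y => ?_
    rw [← expMeasure_Ioi (hz0 y), ofReal_measureReal]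
    rfl
  rw [Measure.real, h1, integral_eq_lintegral_of_nonneg_ae
    (Eventually.of_forall fun ω => (Real.exp_pos _).le)]
  exact (by fun_prop : Measurable fun ω =>
    Real.exp (-z (N.interference η ρ τ z₀ ω))).aestronglyMeasurable

omit [IsProbabilityMeasure P] in
theorem measureReal_gain (hτ : 0 ≤ τ) : P.real {ω | τ < N.gain ω} = Real.exp (-τ) := by
  rw [← expMeasure_Ioi hτ, ← N.gain_law, Measure.real, Measure.real,
    Measure.map_apply N.gain_meas measurableSet_Ioi]
  rfl

/-- Being a cluster head and exceeding the SINR threshold are both lower bounds on the gain, so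
jointly they bound it by a maximum; dividing by `P(h > τ) = e^{-τ}` adds `τ` to the exponent. -/
theorem successProb_eq_integral (hη : 2 < η) (hρ : 0 < ρ) (hτ : 0 ≤ τ)
    (hlam : 0 < lam) (hmu : 0 < mu) :
    N.successProb η ρ τ σ θ z₀ =
      ∫ ω, Real.exp (τ - max τ (θ * (σ ^ 2 + N.interference η ρ τ z₀ ω) / ρ)) ∂P := by
  have hms : MeasurableSet {ω | τ < N.gain ω} := measurableSet_lt measurable_const N.gain_meas
  have hae : P.real ({ω | τ < N.gain ω} ∩ {ω | θ < N.sinr η ρ τ σ z₀ ω}) =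
      P.real {ω | max τ (θ * (σ ^ 2 + N.interference η ρ τ z₀ ω) / ρ) < N.gain ω} := by
    refine measureReal_congr ?_
    filter_upwards [N.ae_interference_pos (z₀ := z₀) hη hρ hτ hlam hmu] with ω hω
    refine propext ?_
    change (τ < N.gain ω ∧ θ < N.sinr η ρ τ σ z₀ ω) ↔ max τ _ < N.gain ω
    rw [max_lt_iff, sinr, lt_div_iff₀ (by positivity), div_lt_iff₀ hρ, mul_comm ρ]
  rw [successProb, cond_apply hms, ENNReal.toReal_mul, ENNReal.toReal_inv, ← Measure.real,
    ← Measure.real, N.measureReal_gain hτ, hae,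
    N.measureReal_lt_gain (z := fun y => max τ (θ * (σ ^ 2 + y) / ρ)) (by fun_prop)
      (fun y => hτ.trans (le_max_left _ _)), ← integral_const_mul]
  congr with ω
  rw [← Real.exp_neg, ← Real.exp_add]
  ring_nf

theorem integral_exp_sub_interference (hη : 2 < η) (hρ : 0 < ρ) (hθ : 0 < θ) (hτ : 0 ≤ τ)
    (hlam : 0 < lam) (hmu : 0 < mu) :
    ∫ ω, Real.exp (τ - θ * (σ ^ 2 + N.interference η ρ τ z₀ ω) / ρ) ∂P =
      Real.exp (-(σ ^ 2 * θ / ρ) + τ - 2 * (Real.exp (-τ) * (mu / lam) / nZ) * θ ^ (2 / η) *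
          ∫ y in Ioi (θ ^ (-1 / η)), (1 - Real.exp (-τ * y ^ (-η)) / (y ^ (-η) + 1)) * y) /
        (1 + Real.exp (-τ) * (mu / lam) / nZ * ((1 + θ) - Real.exp (-τ * θ)) /
          ((1 + θ) * voronoiConst)) ^ voronoiConst := by
  have hK : 0 ≤ Real.exp (-τ) * (mu / lam) / nZ := by positivity
  have h := N.integral_exp_neg_interference (z₀ := z₀) hη hρ hτ hlam hmu (s := (θ / ρ : ℝ))
    (by rw [Complex.ofReal_re]; positivity)
  rw [interLaplace_ofReal_div _ τ (by linarith) hρ hθ, intraLaplace_ofReal_div hK hτ hρ hθ] at h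
  have h1 : ∀ ω, Complex.exp (-((θ / ρ : ℝ) : ℂ) * N.interference η ρ τ z₀ ω) =
      (Real.exp (-(θ / ρ) * N.interference η ρ τ z₀ ω) : ℝ) := by
    intro ω; push_cast; rfl
  simp_rw [h1] at h
  rw [integral_complex_ofReal] at h
  have h2 := Complex.ofReal_injective (h.trans (Complex.ofReal_mul _ _).symm)
  have h3 : ∀ ω, Real.exp (τ - θ * (σ ^ 2 + N.interference η ρ τ z₀ ω) / ρ) =
      Real.exp (-(σ ^ 2 * θ / ρ) + τ) * Real.exp (-(θ / ρ) * N.interference η ρ τ z₀ ω) := by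
    intro ω
    rw [← Real.exp_add]
    ring_nf
  simp_rw [h3]
  rw [integral_const_mul, h2, ← mul_assoc, ← Real.exp_add, mul_one_div, ← sub_eq_add_neg]

omit [IsProbabilityMeasure P] in
theorem lt_interference_iff (hρ : 0 < ρ) (hθ : 0 < θ) (ω : Ω) :
    τ * ρ / θ - σ ^ 2 < N.interference η ρ τ z₀ ω ↔
      τ < θ * (σ ^ 2 + N.interference η ρ τ z₀ ω) / ρ := by
  rw [sub_lt_iff_lt_add', div_lt_iff₀ hθ, lt_div_iff₀ hρ, mul_comm θ]

theorem memLp_exp_sub_interference (hη : 2 < η) (hρ : 0 < ρ) (hθ : 0 < θ) (hτ : 0 ≤ τ)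
    (hmu : 0 < mu) :
    MemLp (fun ω => Real.exp (τ - θ * (σ ^ 2 + N.interference η ρ τ z₀ ω) / ρ)) 2 P := by
  have hm := N.measurable_interference (η := η) (ρ := ρ) (τ := τ) (z₀ := z₀)
  refine MemLp.of_bound (by fun_prop) (Real.exp τ) ?_
  filter_upwards [N.ae_interference_nonneg (z₀ := z₀) hη hρ hτ hmu] with ω hω
  rw [Real.norm_eq_abs, abs_of_pos (Real.exp_pos _), Real.exp_le_exp, sub_le_self_iff]
  positivity

omit [IsProbabilityMeasure P] in
theorem measurableSet_lt_interference (x : ℝ) :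
    MeasurableSet {ω | x < N.interference η ρ τ z₀ ω} :=
  measurableSet_lt measurable_const N.measurable_interference

theorem memLp_indicator_lt_interference (x : ℝ) :
    MemLp ({ω | x < N.interference η ρ τ z₀ ω}.indicator fun _ => (1 : ℝ)) 2 P :=
  (memLp_const 1).indicator (N.measurableSet_lt_interference x)

omit [IsProbabilityMeasure P] in
theorem integral_indicator_lt_interference (x : ℝ) :
    ∫ ω, {ω | x < N.interference η ρ τ z₀ ω}.indicator (fun _ => (1 : ℝ)) ω ∂P =
      N.interferenceCCDF η ρ τ z₀ x := by
  rw [integral_indicator_const _ (N.measurableSet_lt_interference x)]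
  simp [Measure.real, interferenceCCDF]

theorem interferenceCDF_add_interferenceCCDF (x : ℝ) :
    N.interferenceCDF η ρ τ z₀ x + N.interferenceCCDF η ρ τ z₀ x = 1 := by
  have h := probReal_compl_eq_one_sub (μ := P)
    (N.measurableSet_lt_interference (η := η) (ρ := ρ) (τ := τ) (z₀ := z₀) x)
  have hset : {ω | x < N.interference η ρ τ z₀ ω}ᶜ = {ω | N.interference η ρ τ z₀ ω ≤ x} := by
    ext ω; simp
  rw [hset] at h
  rw [interferenceCDF, interferenceCCDF, ← Measure.real, ← Measure.real, h]
  ring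

theorem covariance_eq (hη : 2 < η) (hρ : 0 < ρ) (hθ : 0 < θ) (hτ : 0 ≤ τ) (hmu : 0 < mu)
    (x : ℝ) :
    covariance (fun ω => Real.exp (τ - θ * (σ ^ 2 + N.interference η ρ τ z₀ ω) / ρ))
        ({ω | x < N.interference η ρ τ z₀ ω}.indicator fun _ => (1 : ℝ)) P =
      (∫ ω, Real.exp (τ - θ * (σ ^ 2 + N.interference η ρ τ z₀ ω) / ρ) *
        {ω | x < N.interference η ρ τ z₀ ω}.indicator (fun _ => (1 : ℝ)) ω ∂P) -
      (∫ ω, Real.exp (τ - θ * (σ ^ 2 + N.interference η ρ τ z₀ ω) / ρ) ∂P) *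
        N.interferenceCCDF η ρ τ z₀ x := by
  rw [covariance_eq_sub (N.memLp_exp_sub_interference hη hρ hθ hτ hmu)
    (N.memLp_indicator_lt_interference x), N.integral_indicator_lt_interference]
  rfl

theorem successProb_eq_add_covariance (hη : 2 < η) (hρ : 0 < ρ) (hθ : 0 < θ) (hτ : 0 ≤ τ)
    (hlam : 0 < lam) (hmu : 0 < mu) :
    N.successProb η ρ τ σ θ z₀ =
      (∫ ω, Real.exp (τ - θ * (σ ^ 2 + N.interference η ρ τ z₀ ω) / ρ) ∂P) *
        N.interferenceCCDF η ρ τ z₀ (τ * ρ / θ - σ ^ 2) +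
      N.interferenceCDF η ρ τ z₀ (τ * ρ / θ - σ ^ 2) +
      covariance (fun ω => Real.exp (τ - θ * (σ ^ 2 + N.interference η ρ τ z₀ ω) / ρ))
        ({ω | τ * ρ / θ - σ ^ 2 < N.interference η ρ τ z₀ ω}.indicator fun _ => (1 : ℝ)) P := by
  set x₀ := τ * ρ / θ - σ ^ 2 with hx
  have hX := N.memLp_exp_sub_interference (σ := σ) (z₀ := z₀) hη hρ hθ hτ hmu
  have hY := N.memLp_indicator_lt_interference (η := η) (ρ := ρ) (τ := τ) (z₀ := z₀) x₀
  have hXY : Integrable (fun ω => Real.exp (τ - θ * (σ ^ 2 + N.interference η ρ τ z₀ ω) / ρ) *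
      {ω | x₀ < N.interference η ρ τ z₀ ω}.indicator (fun _ => (1 : ℝ)) ω) P := hX.integrable_mul hY
  have hYi : Integrable (fun ω =>
      {ω | x₀ < N.interference η ρ τ z₀ ω}.indicator (fun _ => (1 : ℝ)) ω) P := hY.integrable one_le_two
  rw [N.covariance_eq hη hρ hθ hτ hmu, N.successProb_eq_integral hη hρ hτ hlam hmu]
  -- The maximum equals `τ` exactly up to `x₀`, where the exponential is `1`; beyond `x₀` the other
  -- branch takes over.
  have hpt : ∀ ω, Real.exp (τ - max τ (θ * (σ ^ 2 + N.interference η ρ τ z₀ ω) / ρ)) =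
      (1 - {ω | x₀ < N.interference η ρ τ z₀ ω}.indicator (fun _ => (1 : ℝ)) ω) +
      Real.exp (τ - θ * (σ ^ 2 + N.interference η ρ τ z₀ ω) / ρ) *
        {ω | x₀ < N.interference η ρ τ z₀ ω}.indicator (fun _ => (1 : ℝ)) ω := by
    intro ω
    have hiff := N.lt_interference_iff (η := η) (τ := τ) (σ := σ) (z₀ := z₀) hρ hθ ω
    by_cases h : x₀ < N.interference η ρ τ z₀ ω
    · rw [indicator_of_mem (by exact h), max_eq_right (hiff.1 h).le]
      ring
    · rw [indicator_of_notMem (by exact h), max_eq_left (not_lt.1 fun h' => h (hiff.2 h'))]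
      simp
  simp_rw [hpt]
  have h1Y : Integrable (fun ω => 1 -
      {ω | x₀ < N.interference η ρ τ z₀ ω}.indicator (fun _ => (1 : ℝ)) ω) P := (integrable_const 1).sub hYi
  rw [integral_add h1Y hXY, integral_sub (integrable_const 1) hYi,
    N.integral_indicator_lt_interference]
  have hsum := N.interferenceCDF_add_interferenceCCDF (η := η) (ρ := ρ) (τ := τ) (z₀ := z₀) x₀
  simp only [integral_const, probReal_univ, smul_eq_mul, mul_one]
  linarith

/-- With `W` the exponential, `Y` the indicator and `p = E Y ∈ [0, 1]`, the product `(W - 1) (Y -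
p)` is pointwise nonpositive, since `W` crosses `1` precisely at `x₀`. Its mean is the covariance
because `E (Y - p) = 0`. -/
theorem covariance_nonpos (hη : 2 < η) (hρ : 0 < ρ) (hθ : 0 < θ) (hτ : 0 ≤ τ) (hmu : 0 < mu) :
    covariance (fun ω => Real.exp (τ - θ * (σ ^ 2 + N.interference η ρ τ z₀ ω) / ρ))
      ({ω | τ * ρ / θ - σ ^ 2 < N.interference η ρ τ z₀ ω}.indicator fun _ => (1 : ℝ)) P ≤ 0 := by
  set x₀ := τ * ρ / θ - σ ^ 2 with hx
  have hX := N.memLp_exp_sub_interference (σ := σ) (z₀ := z₀) hη hρ hθ hτ hmu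
  have hY := N.memLp_indicator_lt_interference (η := η) (ρ := ρ) (τ := τ) (z₀ := z₀) x₀
  have hXY : Integrable (fun ω => Real.exp (τ - θ * (σ ^ 2 + N.interference η ρ τ z₀ ω) / ρ) *
      {ω | x₀ < N.interference η ρ τ z₀ ω}.indicator (fun _ => (1 : ℝ)) ω) P := hX.integrable_mul hY
  have hXi := hX.integrable one_le_two
  have hYi : Integrable (fun ω =>
      {ω | x₀ < N.interference η ρ τ z₀ ω}.indicator (fun _ => (1 : ℝ)) ω) P := hY.integrable one_le_two
  rw [N.covariance_eq hη hρ hθ hτ hmu]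
  set p := N.interferenceCCDF η ρ τ z₀ x₀ with hp
  have hp0 : 0 ≤ p := ENNReal.toReal_nonneg
  have hp1 : p ≤ 1 := by
    have h := N.interferenceCDF_add_interferenceCCDF (η := η) (ρ := ρ) (τ := τ) (z₀ := z₀) x₀
    have h' : 0 ≤ N.interferenceCDF η ρ τ z₀ x₀ := ENNReal.toReal_nonneg
    linarith
  have hpt : ∀ ω, Real.exp (τ - θ * (σ ^ 2 + N.interference η ρ τ z₀ ω) / ρ) *
        {ω | x₀ < N.interference η ρ τ z₀ ω}.indicator (fun _ => (1 : ℝ)) ω -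
      Real.exp (τ - θ * (σ ^ 2 + N.interference η ρ τ z₀ ω) / ρ) * p -
      ({ω | x₀ < N.interference η ρ τ z₀ ω}.indicator (fun _ => (1 : ℝ)) ω - p) ≤ 0 := by
    intro ω
    have hiff := N.lt_interference_iff (η := η) (τ := τ) (σ := σ) (z₀ := z₀) hρ hθ ω
    by_cases h : x₀ < N.interference η ρ τ z₀ ω
    · rw [indicator_of_mem (by exact h)]
      have : Real.exp (τ - θ * (σ ^ 2 + N.interference η ρ τ z₀ ω) / ρ) ≤ 1 :=
        Real.exp_le_one_iff.2 (sub_nonpos.2 (hiff.1 h).le)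
      nlinarith
    · rw [indicator_of_notMem (by exact h)]
      have : 1 ≤ Real.exp (τ - θ * (σ ^ 2 + N.interference η ρ τ z₀ ω) / ρ) :=
        Real.one_le_exp (sub_nonneg.2 (not_lt.1 fun h' => h (hiff.2 h')))
      nlinarith
  have hint := integral_nonpos (μ := P) hpt
  have hA : Integrable (fun ω => Real.exp (τ - θ * (σ ^ 2 + N.interference η ρ τ z₀ ω) / ρ) *
      {ω | x₀ < N.interference η ρ τ z₀ ω}.indicator (fun _ => (1 : ℝ)) ω -
      Real.exp (τ - θ * (σ ^ 2 + N.interference η ρ τ z₀ ω) / ρ) * p) P :=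
    hXY.sub (hXi.mul_const p)
  have hB : Integrable (fun ω =>
      {ω | x₀ < N.interference η ρ τ z₀ ω}.indicator (fun _ => (1 : ℝ)) ω - p) P :=
    hYi.sub (integrable_const p)
  rw [integral_sub hA hB,
    integral_sub hXY (hXi.mul_const p), integral_sub hYi (integrable_const p),
    N.integral_indicator_lt_interference, integral_mul_const] at hint
  simpa [← hp] using hint

end Network

end RandomAccess

theorem theorem2 {Ω : Type*} [MeasurableSpace Ω] (P : Measure Ω) [IsProbabilityMeasure P]
    (lam mu α δ τ η ρ σ θ : ℝ) (nZ : ℕ) (z₀ : Fin nZ)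
    (hlam : 0 < lam) (hmu : 0 < mu) (hα : α = mu / lam)
    (hδ₀ : 0 < δ) (hδ₁ : δ ≤ 1) (hτ : τ = -Real.log δ)
    (hη : 2 < η) (hρ : 0 < ρ) (hθ : 0 < θ)
    (N : RandomAccess.Network P lam mu nZ) :
    -- the inter-cell interference is an almost surely convergent sum
    (∀ᵐ ω ∂P, Summable fun m => N.interTerm η ρ τ z₀ m ω) ∧
    -- Laplace transforms of the intra-cell, inter-cell and aggregate interference
    (∀ s : ℂ, 0 ≤ s.re →
      (∫ ω, Complex.exp (-s * N.intraInterference ρ τ z₀ ω) ∂P =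
          RandomAccess.intraLaplace (δ * α / nZ) ρ τ s) ∧
      (∫ ω, Complex.exp (-s * N.interInterference η ρ τ z₀ ω) ∂P =
          RandomAccess.interLaplace (δ * α / nZ) η ρ τ s) ∧
      (∫ ω, Complex.exp (-s * N.interference η ρ τ z₀ ω) ∂P =
          RandomAccess.interLaplace (δ * α / nZ) η ρ τ s *
            RandomAccess.intraLaplace (δ * α / nZ) ρ τ s)) ∧
    -- Gil-Pelaez inversion: distribution function of the aggregate interference
    (∀ x : ℝ,
      IntegrableOn (fun t : ℝ => 1 / t *
        (Complex.exp (-Complex.I * t * x) *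
          (RandomAccess.interLaplace (δ * α / nZ) η ρ τ (-Complex.I * t) *
            RandomAccess.intraLaplace (δ * α / nZ) ρ τ (-Complex.I * t))).im) (Ioi 0) ∧
      N.interferenceCDF η ρ τ z₀ x = 1 / 2 - 1 / Real.pi * ∫ t in Ioi (0 : ℝ), 1 / t *
        (Complex.exp (-Complex.I * t * x) *
          (RandomAccess.interLaplace (δ * α / nZ) η ρ τ (-Complex.I * t) *
            RandomAccess.intraLaplace (δ * α / nZ) ρ τ (-Complex.I * t))).im) ∧
    -- success probability; the closed form neglects the covariance in the last line
    N.successProb η ρ τ σ θ z₀ =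
      Real.exp (-(σ ^ 2 * θ / ρ) + τ - 2 * (δ * α / nZ) * θ ^ (2 / η) *
          ∫ y in Ioi (θ ^ (-1 / η)), (1 - Real.exp (-τ * y ^ (-η)) / (y ^ (-η) + 1)) * y) /
        (1 + δ * α / nZ * ((1 + θ) - Real.exp (-τ * θ)) /
          ((1 + θ) * RandomAccess.voronoiConst)) ^ RandomAccess.voronoiConst *
        N.interferenceCCDF η ρ τ z₀ (τ * ρ / θ - σ ^ 2) +
      N.interferenceCDF η ρ τ z₀ (τ * ρ / θ - σ ^ 2) +
      covariance (fun ω => Real.exp (τ - θ * (σ ^ 2 + N.interference η ρ τ z₀ ω) / ρ))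
        ({ω | τ * ρ / θ - σ ^ 2 < N.interference η ρ τ z₀ ω}.indicator fun _ => (1 : ℝ)) P ∧
    -- the neglected covariance is not positive: the closed form is an upper bound
    covariance (fun ω => Real.exp (τ - θ * (σ ^ 2 + N.interference η ρ τ z₀ ω) / ρ))
        ({ω | τ * ρ / θ - σ ^ 2 < N.interference η ρ τ z₀ ω}.indicator fun _ => (1 : ℝ)) P ≤ 0 := by
  have hτ0 : 0 ≤ τ := by
    rw [hτ, neg_nonneg]
    exact Real.log_nonpos hδ₀.le hδ₁
  -- The fraction of cluster heads is the exponential tail at `τ`, the form in which it arises in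
  -- the transforms.
  have hexp : δ = Real.exp (-τ) := by rw [hτ, neg_neg, Real.exp_log hδ₀]
  have hK : δ * α / nZ = Real.exp (-τ) * (mu / lam) / nZ := by rw [hexp, hα]
  rw [hK]
  refine ⟨N.ae_summable_interTerm hη hρ hlam hmu, fun s hs =>
    ⟨N.integral_exp_neg_intraInterference hρ hτ0 hlam hmu hs,
      N.integral_exp_neg_interInterference hη hρ hτ0 hlam hmu hs,
      N.integral_exp_neg_interference hη hρ hτ0 hlam hmu hs⟩, fun x => ?_, ?_,
    N.covariance_nonpos hη hρ hθ hτ0 hmu⟩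
  · have := Measure.isProbabilityMeasure_map (μ := P)
      (N.measurable_interference (η := η) (ρ := ρ) (τ := τ) (z₀ := z₀)).aemeasurable
    have hid := N.integrable_id_map_interference (τ := τ) (z₀ := z₀) hη hρ hlam hmu
    have hφ := N.integrableOn_charFun_map_interference (z₀ := z₀) hη hρ hτ0 hlam hmu
    simp_rw [← N.charFun_map_interference (z₀ := z₀) hη hρ hτ0 hlam hmu]
    rw [N.interferenceCDF_eq]
    exact ⟨RandomAccess.integrableOn_gilPelaez _ hid hφ x,
      RandomAccess.measureReal_Iic_eq_gilPelaez _ hid hφ x⟩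
  · rw [N.successProb_eq_add_covariance hη hρ hθ hτ0 hlam hmu,
      N.integral_exp_sub_interference hη hρ hθ hτ0 hlam hmu]
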